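/- A partition is a finite set of pairwise disjoint non-empty sets, called its blocks; an $m$-partition is a partition with exactly $m$ blocks, and $\cup P$ denotes the union of the blocks of $P$. For $n\ge 1$ let $[n]=\{1,\dots,n\}$; all blocks below are subsets of $[n]$. Let $\mathcal P(n,k)$ be the collection of $k$-partitions $P$ with $\cup P=[n]$, and let $S(n,k)=|\mathcal P(n,k)|$ denote the Stirling number of the second kind. A family $\mathcal F\subseteq\mathcal P(n,k)$ is $t$-intersecting if $|P\cap Q|\ge t$ (that is, $P$ and $Q$ share at least $t$ blocks) for all $P,Q\in\mathcal F$. A $t$-intersecting family $\mathcal F\subseteq\mathcal P(n,k)$ is trivial if all its members contain a common $t$-partition, and non-trivial otherwise; it is maximal if it is not properly contained in another $t$-intersecting family $\mathcal G\subseteq\mathcal P(n,k)$. Two families in $\mathcal P(n,k)$ are isomorphic if some permutation of $[n]$ maps one onto the other. Put $$L(k,t)=(t+1)+(k-t+1)\log_2\bigl((t+1)(k-t+1)\bigr).$$ For a $(t+2)$-partition $Z$ (not necessarily covering $[n]$) let $$\mathcal A(Z)=\{F\in\mathcal P(n,k): |F\cap Z|\ge t+1\}.$$ For a $k$-partition $M$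 (not necessarily covering $[n]$) and $X\subseteq M$ with $|X|=t$ let $$\mathcal H(X,M)=\{F\in\mathcal P(n,k): X\subseteq F,\ F\cap(M\setminus X)\ne\emptyset\}\ \cup\ \bigl\{(M\setminus\{B\})\cup\{B\cup([n]\setminus\cup M)\}: B\in X\bigr\}.$$ With $[[m]]=\{\{1\},\dots,\{m\}\}$ set $\mathcal H(n,k,t)=\mathcal H([[t]],[[k]])$ and $\mathcal H_1(n,k,t)=\mathcal H([[t]],[[k-1]]\cup\{\{k,k+1\}\})$. Theorem. Let $n,k,t$ be positive integers with $k\ge t+3$ and $n\ge 2L(k,t)$, and let $\mathcal F\subseteq\mathcal P(n,k)$ be a maximal non-trivial $t$-intersecting family. (i) Suppose $k\ge 2t+3$. If $|\mathcal F|\ge|\mathcal H(n,k,t)|-S(n-t-1,k-t-1)+S(n-t-2,k-t-1)$, then $\mathcal F$ is isomorphic to $\mathcal H(n,k,t)$ or to $\mathcal H_1(n,k,t)$. (ii) Suppose $t+3\le k\le 2t+2$. If $|\mathcal F|>|\mathcal H(n,k,t)|$, then $\mathcal F=\mathcal A(Z)$ for some $(t+2)$-partition $Z$. -/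

import Mathlib

namespace BlockPartition

/-- A partition: a set of pairwise disjoint non-empty blocks. Its blocks need not cover the
ground set `Fin n`, which plays the role of `[n]`. -/
def IsPartition {n : ℕ} (P : Finset (Finset (Fin n))) : Prop :=
  (∀ A ∈ P, A.Nonempty) ∧ ∀ A ∈ P, ∀ B ∈ P, A ≠ B → Disjoint A B

instance {n : ℕ} (P : Finset (Finset (Fin n))) : Decidable (IsPartition P) :=
  inferInstanceAs (Decidable (_ ∧ _))

/-- The union of the blocks of `P`. -/
def support {n : ℕ} (P : Finset (Finset (Fin n))) : Finset (Fin n) :=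
  P.biUnion id

/-- The collection of all partitions of the whole ground set `Fin n` with exactly `k` blocks. -/
def kPartitions (n k : ℕ) : Finset (Finset (Finset (Fin n))) :=
  Finset.univ.filter fun P => IsPartition P ∧ support P = Finset.univ ∧ P.card = k

/-- Every two members share at least `t` blocks. -/
def IsIntersecting {n : ℕ} (t : ℕ) (𝓕 : Finset (Finset (Finset (Fin n)))) : Prop :=
  ∀ P ∈ 𝓕, ∀ Q ∈ 𝓕, t ≤ (P ∩ Q).card

/-- All members contain a common `t`-partition. -/
def IsTrivial {n : ℕ} (t : ℕ) (𝓕 : Finset (Finset (Finset (Fin n)))) : Prop :=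
  ∃ X : Finset (Finset (Fin n)), IsPartition X ∧ X.card = t ∧ ∀ P ∈ 𝓕, X ⊆ P

/-- `𝓕` is inclusion-maximal among the `t`-intersecting families of `k`-partitions of `Fin n`. -/
def IsMaximalIntersecting (n k t : ℕ) (𝓕 : Finset (Finset (Finset (Fin n)))) : Prop :=
  Maximal (fun 𝓖 : Finset (Finset (Finset (Fin n))) =>
    𝓖 ⊆ kPartitions n k ∧ IsIntersecting t 𝓖) 𝓕

/-- The two families are the same up to a permutation of the ground set. -/
def Isomorphic {n : ℕ} (𝓖₁ 𝓖₂ : Finset (Finset (Finset (Fin n)))) : Prop :=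
  ∃ σ : Equiv.Perm (Fin n),
    𝓖₁.image (fun P => P.image fun B => B.image σ) = 𝓖₂

/-- The set of the first `m` elements of the ground set. -/
def firstElems (n m : ℕ) : Finset (Fin n) :=
  Finset.univ.filter fun i => i.val < m

/-- The partition of `B` into singletons. -/
def singletons {n : ℕ} (B : Finset (Fin n)) : Finset (Finset (Fin n)) :=
  B.image fun i => {i}

/-- The `k`-partitions sharing at least `t + 1` blocks with `Z`. -/
def familyA (n k t : ℕ) (Z : Finset (Finset (Fin n))) : Finset (Finset (Finset (Fin n))) :=
  (kPartitions n k).filter fun F => t + 1 ≤ (F ∩ Z).card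

/-- The `k`-partitions containing `X` and at least one block of `M \ X`, together with the
partitions obtained from `M` by enlarging one block `B ∈ X` by all uncovered elements. -/
def familyH (n k : ℕ) (X M : Finset (Finset (Fin n))) : Finset (Finset (Finset (Fin n))) :=
  ((kPartitions n k).filter fun F => X ⊆ F ∧ (F ∩ (M \ X)).Nonempty) ∪
    X.image fun B => (M \ {B}) ∪ {B ∪ (support M)ᶜ}

/-- `familyH` for the first `t` singletons inside the first `k` singletons. -/
def familyH₀ (n k t : ℕ) : Finset (Finset (Finset (Fin n))) :=
  familyH n k (singletons (firstElems n t)) (singletons (firstElems n k))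

/-- `familyH` for the first `t` singletons inside the partition consisting of the first `k - 1`
singletons and the block formed by the `k`-th and `(k + 1)`-st elements. -/
def familyH₁ (n k t : ℕ) : Finset (Finset (Finset (Fin n))) :=
  familyH n k (singletons (firstElems n t))
    (singletons (firstElems n (k - 1)) ∪ {firstElems n (k + 1) \ firstElems n (k - 1)})

/-- `L(k,t) = (t+1) + (k-t+1) log₂((t+1)(k-t+1))`. -/
noncomputable def boundL (k t : ℕ) : ℝ :=
  ((t : ℝ) + 1) + ((k : ℝ) - t + 1) * Real.logb 2 (((t : ℝ) + 1) * ((k : ℝ) - t + 1))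

end BlockPartition

/-!
Let `𝓕` be a maximal non-trivial `t`-intersecting family, and write `m = k - t + 1`,
`j = k - t - 1`, `f₁ = S(n - t - 1, k - t - 1)` and `f₂ = S(n - t - 2, k - t - 2)`. At most `f₁`
partitions contain `t + 1` given blocks, and at most `f₂` contain `t + 2` given blocks. The
families `familyH₀` and `familyA` have about `(k - t) f₁` and `(t + 2) f₁` members respectively,
so most of the theorem follows from a description of `𝓕` up to an error small compared with
`f₁`.

**Ratios of Stirling numbers.** Splitting one block of a partition into two, and averaging
`2 ^ |B|` over the blocks with the inequality of arithmetic and geometric means, bounds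
`S(N, q + 1) / S(N, q)` from below by about `2 ^ (N / q) / (q + 1)`
(`stirlingSecond_mul_le_succ_right`). Since `n ≥ 2 L(k, t)` says `2 ^ n ≥ 4 ^ (t + 1) D ^ m` with
`D = ((t + 1) m) ^ 2`, this gives `D f₂ ≤ f₁` (`ratio_le`) and
`(t + 1) ^ 2 m f₂ ≤ S(n - t - 2, k - t - 1)` (`ratio_same_ground_le`).

**Branching.** Call a set of blocks a cover if it shares `t` blocks with every member of `𝓕`. If
`U` is not a cover, some `m` blocks outside `U` meet every member (`exists_hitting_set`). Hence a
family without a cover by `t + 1` blocks has at most `f₁` members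
(`card_le_of_no_small_cover`). Otherwise call a set of `t + 1` blocks heavy if more than
`max m (t + 1) f₂` members contain it. A heavy set is a cover, two heavy sets share `t` blocks,
and all but at most `f₁ / 2` members contain a heavy set.

**Structure.** With at most two heavy sets `𝓕` is too small. If the heavy sets have no `t` blocks
in common, three of them lie in a `(t + 2)`-set `Z`, and this forces `𝓕 = familyA Z`. Otherwise
they are the sets `X ∪ {B}` with `B ∈ 𝓑`, where `|𝓑| ≤ k - t`, nearly all members contain `X` and
a block of `𝓑`, and `𝓕 = familyH X (X ∪ 𝓑)` when `|𝓑| = k - t` (`structure_of_maximal`).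

**Comparison.** Shrinking a block of `𝓑` to one of its points never decreases the number of
partitions that contain `X` and meet `𝓑` (`exists_card_meetingFamily_le`), so this number is at
most the one for singletons, `singletonCount`. Near the threshold of the first part the second
order terms have the same size as the error terms of a crude inclusion-exclusion; therefore
`𝓕` is compared with `singletonCount n k t (k - t - 1)` itself, and only the contribution of the
last one or two blocks of `𝓑` is estimated.
-/

/-! ### Partitions of a set and Stirling numbers of the second kind -/

namespace BlockPartition

variable {n : ℕ}

theorem IsPartition.eq_of_mem {P : Finset (Finset (Fin n))} (hP : IsPartition P)
    {A B : Finset (Fin n)} (hA : A ∈ P) (hB : B ∈ P) {x : Fin n} (hxA : x ∈ A) (hxB : x ∈ B) :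
    A = B := by
  by_contra h
  exact Finset.disjoint_left.1 (hP.2 A hA B hB h) hxA hxB

theorem IsPartition.mono {P Q : Finset (Finset (Fin n))} (hP : IsPartition P) (h : Q ⊆ P) :
    IsPartition Q :=
  ⟨fun A hA => hP.1 A (h hA), fun A hA B hB => hP.2 A (h hA) B (h hB)⟩

theorem mem_support {P : Finset (Finset (Fin n))} {x : Fin n} :
    x ∈ support P ↔ ∃ A ∈ P, x ∈ A := by
  simp [support]

theorem support_insert (B : Finset (Fin n)) (P : Finset (Finset (Fin n))) :
    support (insert B P) = B ∪ support P := by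
  simp [support, Finset.biUnion_insert]

theorem support_union (P Q : Finset (Finset (Fin n))) :
    support (P ∪ Q) = support P ∪ support Q := by
  ext x; simp only [mem_support, Finset.mem_union]
  constructor
  · rintro ⟨A, hA | hA, hx⟩
    exacts [Or.inl ⟨A, hA, hx⟩, Or.inr ⟨A, hA, hx⟩]
  · rintro (⟨A, hA, hx⟩ | ⟨A, hA, hx⟩)
    exacts [⟨A, Or.inl hA, hx⟩, ⟨A, Or.inr hA, hx⟩]

theorem IsPartition.card_support {P : Finset (Finset (Fin n))} (hP : IsPartition P) :
    (support P).card = ∑ B ∈ P, B.card :=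
  Finset.card_biUnion fun A hA B hB h => hP.2 A hA B hB h

theorem IsPartition.card_le_card_support {P : Finset (Finset (Fin n))} (hP : IsPartition P) :
    P.card ≤ (support P).card := by
  rw [hP.card_support, Finset.card_eq_sum_ones]
  exact Finset.sum_le_sum fun B hB => (hP.1 B hB).card_pos

theorem isPartition_union {P Q : Finset (Finset (Fin n))} (hP : IsPartition P)
    (hQ : IsPartition Q) (h : Disjoint (support P) (support Q)) : IsPartition (P ∪ Q) := by
  have key : ∀ A ∈ P, ∀ B ∈ Q, Disjoint A B := fun A hA B hB =>
    h.mono (fun x hx => mem_support.2 ⟨A, hA, hx⟩) (fun x hx => mem_support.2 ⟨B, hB, hx⟩)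
  refine ⟨fun A hA => ?_, fun A hA B hB hAB => ?_⟩
  · rcases Finset.mem_union.1 hA with hA | hA
    exacts [hP.1 A hA, hQ.1 A hA]
  · rcases Finset.mem_union.1 hA with hA | hA <;> rcases Finset.mem_union.1 hB with hB | hB
    exacts [hP.2 A hA B hB hAB, key A hA B hB, (key B hB A hA).symm, hQ.2 A hA B hB hAB]

theorem isPartition_singleton {B : Finset (Fin n)} (hB : B.Nonempty) :
    IsPartition ({B} : Finset (Finset (Fin n))) := by
  refine ⟨fun A hA => ?_, fun A hA C hC h => ?_⟩
  · rw [Finset.mem_singleton.1 hA]; exact hB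
  · exact absurd ((Finset.mem_singleton.1 hA).trans (Finset.mem_singleton.1 hC).symm) h

theorem isPartition_insert {P : Finset (Finset (Fin n))} {B : Finset (Fin n)}
    (hP : IsPartition P) (hB : B.Nonempty) (h : Disjoint B (support P)) :
    IsPartition (insert B P) := by
  rw [Finset.insert_eq]
  refine isPartition_union (isPartition_singleton hB) hP ?_
  simpa [support] using h

theorem IsPartition.disjoint_support_erase {P : Finset (Finset (Fin n))} (hP : IsPartition P)
    {B : Finset (Fin n)} (hB : B ∈ P) : Disjoint B (support (P.erase B)) := by
  rw [Finset.disjoint_left]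
  intro x hx hx'
  obtain ⟨A, hA, hxA⟩ := mem_support.1 hx'
  exact (Finset.mem_erase.1 hA).1 (hP.eq_of_mem (Finset.mem_erase.1 hA).2 hB hxA hx)

theorem support_erase {P : Finset (Finset (Fin n))} (hP : IsPartition P)
    {B : Finset (Fin n)} (hB : B ∈ P) : support (P.erase B) = support P \ B := by
  conv_rhs => rw [← Finset.insert_erase hB, support_insert]
  rw [Finset.union_sdiff_cancel_left (hP.disjoint_support_erase hB)]

theorem notMem_of_disjoint_support {P : Finset (Finset (Fin n))} {B : Finset (Fin n)}
    (hB : B.Nonempty) (h : Disjoint B (support P)) : B ∉ P := by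
  intro hBP
  obtain ⟨x, hx⟩ := hB
  exact Finset.disjoint_left.1 h hx (mem_support.2 ⟨B, hBP, hx⟩)

/-- The partitions of the set `W` into exactly `q` blocks. -/
def partitionsOf (W : Finset (Fin n)) (q : ℕ) : Finset (Finset (Finset (Fin n))) :=
  Finset.univ.filter fun P => IsPartition P ∧ support P = W ∧ P.card = q

theorem mem_partitionsOf {W : Finset (Fin n)} {q : ℕ} {P : Finset (Finset (Fin n))} :
    P ∈ partitionsOf W q ↔ IsPartition P ∧ support P = W ∧ P.card = q := by
  simp [partitionsOf]

theorem mem_kPartitions {k : ℕ} {P : Finset (Finset (Fin n))} :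
    P ∈ kPartitions n k ↔ IsPartition P ∧ support P = Finset.univ ∧ P.card = k := by
  simp [kPartitions]

theorem partitionsOf_insert_mem {W : Finset (Fin n)} {a : Fin n} (ha : a ∉ W) (q : ℕ) :
    ((partitionsOf (insert a W) (q + 1)).filter fun P => {a} ∈ P).card
      = (partitionsOf W q).card := by
  refine Finset.card_nbij' (fun P => P.erase {a}) (fun P => insert {a} P) ?_ ?_ ?_ ?_
  · intro P hP
    simp only [Finset.coe_filter, Set.mem_ofPred_eq, mem_partitionsOf] at hP
    obtain ⟨⟨hP, hs, hc⟩, haP⟩ := hP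
    rw [Finset.mem_coe, mem_partitionsOf]
    refine ⟨hP.mono (Finset.erase_subset _ _), ?_, ?_⟩
    · rw [support_erase hP haP, hs]
      ext x; simp only [Finset.mem_sdiff, Finset.mem_insert, Finset.mem_singleton]
      constructor
      · tauto
      · intro hx; exact ⟨Or.inr hx, fun h => ha (h ▸ hx)⟩
    · rw [Finset.card_erase_of_mem haP, hc]; rfl
  · intro P hP
    rw [Finset.mem_coe, mem_partitionsOf] at hP
    obtain ⟨hP, hs, hc⟩ := hP
    have hd : Disjoint {a} (support P) := by rw [hs]; simpa using ha
    simp only [Finset.coe_filter, Set.mem_ofPred_eq, mem_partitionsOf]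
    refine ⟨⟨isPartition_insert hP (Finset.singleton_nonempty a) hd, ?_, ?_⟩,
      Finset.mem_insert_self _ _⟩
    · rw [support_insert, hs]; rfl
    · rw [Finset.card_insert_of_notMem
        (notMem_of_disjoint_support (Finset.singleton_nonempty a) hd), hc]
  · intro P hP
    simp only [Finset.coe_filter, Set.mem_ofPred_eq] at hP
    exact Finset.insert_erase hP.2
  · intro P hP
    rw [Finset.mem_coe, mem_partitionsOf] at hP
    obtain ⟨hP, hs, hc⟩ := hP
    have hd : Disjoint {a} (support P) := by rw [hs]; simpa using ha
    exact Finset.erase_insert (notMem_of_disjoint_support (Finset.singleton_nonempty a) hd)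

theorem partitionsOf_insert_notMem {W : Finset (Fin n)} {a : Fin n} (ha : a ∉ W) (q : ℕ) :
    ((partitionsOf (insert a W) (q + 1)).filter fun P => {a} ∉ P).card
      = (q + 1) * (partitionsOf W (q + 1)).card := by
  have h1 : ((partitionsOf W (q + 1)).sigma fun P => P).card
      = (q + 1) * (partitionsOf W (q + 1)).card := by
    rw [Finset.card_sigma, Finset.sum_congr rfl fun P hP => (mem_partitionsOf.1 hP).2.2]
    simp [mul_comm]
  rw [← h1]
  symm
  refine Finset.card_bij (fun p _ => insert (insert a p.2) (p.1.erase p.2)) ?_ ?_ ?_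
  · rintro ⟨P, B⟩ hp
    obtain ⟨hP, hB⟩ := Finset.mem_sigma.1 hp
    obtain ⟨hP, hs, hc⟩ := mem_partitionsOf.1 hP
    dsimp only at hB hP hs hc ⊢
    have hd : Disjoint (insert a B) (support (P.erase B)) := by
      rw [Finset.disjoint_insert_left]
      refine ⟨fun h => ha ?_, hP.disjoint_support_erase hB⟩
      rw [support_erase hP hB, hs] at h
      exact (Finset.mem_sdiff.1 h).1
    have hne : (insert a B).Nonempty := Finset.insert_nonempty a B
    rw [Finset.mem_filter, mem_partitionsOf]
    refine ⟨⟨isPartition_insert (hP.mono (Finset.erase_subset _ _)) hne hd, ?_, ?_⟩, ?_⟩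
    · rw [support_insert, Finset.insert_union, ← support_insert, Finset.insert_erase hB, hs]
    · rw [Finset.card_insert_of_notMem (notMem_of_disjoint_support hne hd),
        Finset.card_erase_of_mem hB, hc]; rfl
    · intro h
      rcases Finset.mem_insert.1 h with h | h
      · obtain ⟨x, hx⟩ := hP.1 B hB
        have : x ∈ ({a} : Finset (Fin n)) := h ▸ Finset.mem_insert_of_mem hx
        rw [Finset.mem_singleton] at this
        subst this
        exact ha (hs ▸ mem_support.2 ⟨B, hB, hx⟩)
      · exact ha (hs ▸ mem_support.2 ⟨{a}, Finset.mem_of_mem_erase h, Finset.mem_singleton_self a⟩)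
  · rintro ⟨P, B⟩ hp ⟨P', B'⟩ hp' heq
    obtain ⟨hP, hB⟩ := Finset.mem_sigma.1 hp
    obtain ⟨hP, hs, hc⟩ := mem_partitionsOf.1 hP
    obtain ⟨hP', hB'⟩ := Finset.mem_sigma.1 hp'
    obtain ⟨hP', hs', hc'⟩ := mem_partitionsOf.1 hP'
    dsimp only at hB hP hs hc hB' hP' hs' hc' heq
    have hna : ∀ C ∈ P, a ∉ C := fun C hC h => ha (hs ▸ mem_support.2 ⟨C, hC, h⟩)
    have hna' : ∀ C ∈ P', a ∉ C := fun C hC h => ha (hs' ▸ mem_support.2 ⟨C, hC, h⟩)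
    have h2 : insert a B = insert a B' := by
      have : insert a B ∈ insert (insert a B') (P'.erase B') := heq ▸ Finset.mem_insert_self _ _
      rcases Finset.mem_insert.1 this with h | h
      · exact h
      · exact absurd (Finset.mem_insert_self a B) (hna' _ (Finset.mem_of_mem_erase h))
    have h3 : B = B' := by
      rw [← Finset.erase_insert (hna B hB), h2, Finset.erase_insert (hna' B' hB')]
    subst h3
    have h4 : P.erase B = P'.erase B := by
      have hx : insert a B ∉ P.erase B := fun h =>
        hna _ (Finset.mem_of_mem_erase h) (Finset.mem_insert_self a B)
      have hx' : insert a B ∉ P'.erase B := fun h =>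
        hna' _ (Finset.mem_of_mem_erase h) (Finset.mem_insert_self a B)
      rw [← Finset.erase_insert hx, heq, Finset.erase_insert hx']
    have h5 : P = P' := by
      rw [← Finset.insert_erase hB, h4, Finset.insert_erase hB']
    subst h5
    rfl
  · intro Q hQ
    rw [Finset.mem_filter, mem_partitionsOf] at hQ
    obtain ⟨⟨hQ, hs, hc⟩, haQ⟩ := hQ
    obtain ⟨C, hC, haC⟩ := mem_support.1 (hs ▸ Finset.mem_insert_self a W)
    have hne : (C.erase a).Nonempty := by
      rw [Finset.nonempty_iff_ne_empty, Ne, Finset.erase_eq_empty_iff]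
      rintro (h | h)
      · simp [h] at haC
      · exact haQ (h ▸ hC)
    have hd : Disjoint (C.erase a) (support (Q.erase C)) :=
      (hQ.disjoint_support_erase hC).mono_left (Finset.erase_subset _ _)
    have hnm := notMem_of_disjoint_support hne hd
    refine ⟨⟨insert (C.erase a) (Q.erase C), C.erase a⟩, ?_, ?_⟩
    · rw [Finset.mem_sigma, mem_partitionsOf]
      refine ⟨⟨isPartition_insert (hQ.mono (Finset.erase_subset _ _)) hne hd, ?_, ?_⟩,
        Finset.mem_insert_self _ _⟩
      · have h1 : a ∉ support (Q.erase C) :=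
          fun h => Finset.disjoint_left.1 (hQ.disjoint_support_erase hC) haC h
        have h2 : insert a (support (insert (C.erase a) (Q.erase C))) = insert a W := by
          rw [support_insert, ← Finset.insert_union, Finset.insert_erase haC, ← support_insert,
            Finset.insert_erase hC, hs]
        have h3 : a ∉ support (insert (C.erase a) (Q.erase C)) := by
          rw [support_insert, Finset.mem_union]
          simp [h1]
        rw [← Finset.erase_insert h3, h2, Finset.erase_insert ha]
      · rw [Finset.card_insert_of_notMem hnm, Finset.card_erase_of_mem hC, hc]; rfl
    · dsimp only
      rw [Finset.erase_insert hnm, Finset.insert_erase haC, Finset.insert_erase hC]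

/-- Partitions into `q` blocks are counted by the Stirling number `Nat.stirlingSecond`: the first
point either forms a block of its own or is added to a block of a partition of the other points. -/
theorem card_partitionsOf (W : Finset (Fin n)) (q : ℕ) :
    (partitionsOf W q).card = Nat.stirlingSecond W.card q := by
  induction W using Finset.induction_on generalizing q with
  | empty =>
    have hmem : ∀ P : Finset (Finset (Fin n)), IsPartition P ∧ support P = ∅ ↔ P = ∅ := by
      intro P
      constructor
      · rintro ⟨hP, hs⟩
        rw [Finset.eq_empty_iff_forall_notMem]
        intro A hA
        obtain ⟨x, hx⟩ := hP.1 A hA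
        have : x ∈ support P := mem_support.2 ⟨A, hA, hx⟩
        rw [hs] at this
        simp at this
      · rintro rfl
        simp [IsPartition, support]
    cases q with
    | zero =>
      rw [Finset.card_empty, Nat.stirlingSecond_zero, Finset.card_eq_one]
      refine ⟨∅, ?_⟩
      ext P
      rw [mem_partitionsOf, ← and_assoc, hmem, Finset.mem_singleton]
      constructor
      · exact fun h => h.1
      · rintro rfl; simp
    | succ q =>
      rw [Finset.card_empty, Nat.stirlingSecond_zero_succ, Finset.card_eq_zero,
        Finset.eq_empty_iff_forall_notMem]
      intro P hP
      rw [mem_partitionsOf, ← and_assoc, hmem] at hP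
      obtain ⟨rfl, h⟩ := hP
      simp at h
  | insert a W ha ih =>
    rw [Finset.card_insert_of_notMem ha]
    cases q with
    | zero =>
      rw [Nat.stirlingSecond_succ_zero, Finset.card_eq_zero, Finset.eq_empty_iff_forall_notMem]
      intro P hP
      obtain ⟨-, hs, hc⟩ := mem_partitionsOf.1 hP
      rw [Finset.card_eq_zero] at hc
      subst hc
      have := Finset.mem_insert_self a W
      rw [← hs] at this
      simp [support] at this
    | succ q =>
      rw [Nat.stirlingSecond_succ_succ, ← ih, ← ih, ← partitionsOf_insert_mem ha q,
        ← partitionsOf_insert_notMem ha q,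
        ← Finset.card_filter_add_card_filter_not (s := partitionsOf (insert a W) (q + 1))
          (fun P => {a} ∈ P)]
      exact Nat.add_comm _ _

/-- Splitting a block `B` of `P` into `C` and `B \ C` embeds the pairs (partition into `q` blocks,
proper non-empty subset of one of its blocks) into the pairs (partition into `q + 1` blocks,
ordered pair of distinct blocks). -/
theorem sum_split_le (W : Finset (Fin n)) (q : ℕ) :
    ∑ P ∈ partitionsOf W q, ∑ B ∈ P, (2 ^ B.card - 2)
      ≤ (q + 1) * q * (partitionsOf W (q + 1)).card := by
  let src : Finset (Σ _ : Finset (Finset (Fin n)), Σ _ : Finset (Fin n), Finset (Fin n)) :=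
    (partitionsOf W q).sigma fun P => P.sigma fun B => (B.powerset.erase B).erase ∅
  let tgt : Finset (Σ _ : Finset (Finset (Fin n)), Finset (Fin n) × Finset (Fin n)) :=
    (partitionsOf W (q + 1)).sigma fun P => P.offDiag
  have hsrc : src.card = ∑ P ∈ partitionsOf W q, ∑ B ∈ P, (2 ^ B.card - 2) := by
    simp only [src, Finset.card_sigma]
    refine Finset.sum_congr rfl fun P hP => Finset.sum_congr rfl fun B hB => ?_
    have hne := (mem_partitionsOf.1 hP).1.1 B hB
    rw [Finset.card_erase_of_mem, Finset.card_erase_of_mem, Finset.card_powerset]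
    · rfl
    · exact Finset.mem_powerset_self B
    · exact Finset.mem_erase.2 ⟨hne.ne_empty.symm, Finset.empty_mem_powerset B⟩
  have htgt : tgt.card = (q + 1) * q * (partitionsOf W (q + 1)).card := by
    simp only [tgt, Finset.card_sigma]
    rw [Finset.sum_congr rfl fun P hP => by
      rw [Finset.offDiag_card, (mem_partitionsOf.1 hP).2.2]]
    rw [Finset.sum_const, smul_eq_mul, mul_comm]
    congr 1
    rw [Nat.mul_add, mul_one, Nat.add_sub_cancel]
  rw [← hsrc, ← htgt]
  have hdata : ∀ p ∈ src, p.1 ∈ partitionsOf W q ∧ p.2.1 ∈ p.1 ∧ p.2.2 ⊆ p.2.1 ∧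
      p.2.2.Nonempty ∧ (p.2.1 \ p.2.2).Nonempty := by
    rintro ⟨P, B, C⟩ hp
    simp only [src, Finset.mem_sigma, Finset.mem_erase, Finset.mem_powerset] at hp
    obtain ⟨hP, hB, hC, hCB, hs⟩ := hp
    exact ⟨hP, hB, hs, Finset.nonempty_iff_ne_empty.2 hC,
      Finset.sdiff_nonempty.2 fun h => hCB (hs.antisymm h)⟩
  have hnot : ∀ p ∈ src, p.2.1 \ p.2.2 ∉ p.1.erase p.2.1 ∧
      p.2.2 ∉ insert (p.2.1 \ p.2.2) (p.1.erase p.2.1) := by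
    intro p hp
    obtain ⟨hP, hB, hs, hC, hBC⟩ := hdata p hp
    have hd := (mem_partitionsOf.1 hP).1.disjoint_support_erase hB
    have h1 := notMem_of_disjoint_support hBC (hd.mono_left Finset.sdiff_subset)
    have h2 := notMem_of_disjoint_support hC (hd.mono_left hs)
    refine ⟨h1, fun h => ?_⟩
    rcases Finset.mem_insert.1 h with h | h
    · obtain ⟨x, hx⟩ := hC
      have := h ▸ hx
      exact (Finset.mem_sdiff.1 this).2 hx
    · exact h2 h
  refine Finset.card_le_card_of_injOn
    (fun p => ⟨insert p.2.2 (insert (p.2.1 \ p.2.2) (p.1.erase p.2.1)),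
      (p.2.2, p.2.1 \ p.2.2)⟩) ?_ ?_
  · intro p hp
    obtain ⟨hP, hB, hs, hC, hBC⟩ := hdata p hp
    obtain ⟨h1, h2⟩ := hnot p hp
    obtain ⟨hP, hsup, hc⟩ := mem_partitionsOf.1 hP
    have hd := hP.disjoint_support_erase hB
    simp only [tgt, Finset.coe_sigma, Set.mem_sigma_iff, Finset.mem_coe, mem_partitionsOf,
      Finset.mem_offDiag]
    refine ⟨⟨isPartition_insert (isPartition_insert (hP.mono (Finset.erase_subset _ _)) hBC
      (hd.mono_left Finset.sdiff_subset)) hC ?_, ?_, ?_⟩, Finset.mem_insert_self _ _, ?_, ?_⟩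
    · rw [support_insert, Finset.disjoint_union_right]
      exact ⟨Finset.disjoint_sdiff, hd.mono_left hs⟩
    · rw [support_insert, support_insert, ← Finset.union_assoc, Finset.union_sdiff_of_subset hs,
        ← support_insert, Finset.insert_erase hB, hsup]
    · have : 0 < p.1.card := Finset.card_pos.2 ⟨_, hB⟩
      rw [Finset.card_insert_of_notMem h2, Finset.card_insert_of_notMem h1,
        Finset.card_erase_of_mem hB]
      omega
    · exact Finset.mem_insert_of_mem (Finset.mem_insert_self _ _)
    · intro h
      obtain ⟨x, hx⟩ := hC
      have := h ▸ hx
      exact (Finset.mem_sdiff.1 this).2 hx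
  · -- the split is undone by merging the two distinguished blocks
    refine Set.LeftInvOn.injOn (f₁' := fun r =>
      ⟨insert (r.2.1 ∪ r.2.2) ((r.1.erase r.2.1).erase r.2.2), ⟨r.2.1 ∪ r.2.2, r.2.1⟩⟩) ?_
    rintro ⟨P, B, C⟩ hp
    obtain ⟨hP, hB, hs, hC, hBC⟩ := hdata _ hp
    obtain ⟨h1, h2⟩ := hnot _ hp
    dsimp only at hP hB hs hC hBC h1 h2 ⊢
    rw [Finset.union_sdiff_of_subset hs, Finset.erase_insert h2, Finset.erase_insert h1,
      Finset.insert_erase hB]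

/-- The inequality of arithmetic and geometric means for the numbers `2 ^ |B|`. -/
theorem card_mul_le_sum_two_pow {ι : Type*} (s : Finset ι) (g : ι → ℕ) (c : ℕ)
    (h : c ^ s.card ≤ 2 ^ ∑ i ∈ s, g i) : s.card * c ≤ ∑ i ∈ s, 2 ^ g i := by
  rcases s.eq_empty_or_nonempty with rfl | hs
  · simp
  have hq : (0 : ℝ) < s.card := by exact_mod_cast hs.card_pos
  have key := Real.geom_mean_le_arith_mean s (fun _ => 1) (fun i => (2 : ℝ) ^ g i)
    (fun _ _ => zero_le_one) (by simpa using hq) (fun _ _ => by positivity)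
  simp only [Real.rpow_one, Finset.sum_const, nsmul_eq_mul, mul_one, one_mul] at key
  rw [Finset.prod_pow_eq_pow_sum] at key
  have h2 : (c : ℝ) ≤ ((2 : ℝ) ^ ∑ i ∈ s, g i) ^ (s.card : ℝ)⁻¹ := by
    rw [Real.le_rpow_inv_iff_of_pos (by positivity) (by positivity) hq, Real.rpow_natCast]
    exact_mod_cast h
  have h3 := h2.trans key
  rw [le_div_iff₀ hq] at h3
  have h4 : ((c * s.card : ℕ) : ℝ) ≤ ((∑ i ∈ s, 2 ^ g i : ℕ) : ℝ) := by
    push_cast; exact h3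
  rw [mul_comm]
  exact_mod_cast h4

/-- The splitting count `sum_split_le`, where the mean of `2 ^ |B|` over the `q` blocks is at least
`2 ^ (N / q) ≥ c`. -/
theorem stirlingSecond_mul_le_succ_right {N q c : ℕ} (hq : 1 ≤ q) (hc : c ^ q ≤ 2 ^ N) :
    (c - 2) * Nat.stirlingSecond N q ≤ (q + 1) * Nat.stirlingSecond N (q + 1) := by
  have h := sum_split_le (Finset.univ : Finset (Fin N)) q
  have h1 : ∀ P ∈ partitionsOf (Finset.univ : Finset (Fin N)) q,
      q * (c - 2) ≤ ∑ B ∈ P, (2 ^ B.card - 2) := by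
    intro P hP
    obtain ⟨hP, hs, hcard⟩ := mem_partitionsOf.1 hP
    have h2 : P.card * c ≤ ∑ B ∈ P, 2 ^ B.card := by
      apply card_mul_le_sum_two_pow
      rw [← hP.card_support, hs, hcard, Finset.card_univ, Fintype.card_fin]
      exact hc
    have h3 : ∑ B ∈ P, 2 ^ B.card = ∑ B ∈ P, (2 ^ B.card - 2) + P.card * 2 := by
      rw [← smul_eq_mul, ← Finset.sum_const, ← Finset.sum_add_distrib]
      refine Finset.sum_congr rfl fun B hB => (Nat.sub_add_cancel ?_).symm
      calc 2 = 2 ^ 1 := rfl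
        _ ≤ 2 ^ B.card := Nat.pow_le_pow_right two_pos (hP.1 B hB).card_pos
    rw [hcard] at h2 h3
    rw [Nat.mul_sub]
    omega
  have h2 := (Finset.card_nsmul_le_sum _ _ _ h1).trans h
  rw [card_partitionsOf, card_partitionsOf, Finset.card_univ, Fintype.card_fin, smul_eq_mul] at h2
  have h3 : q * ((c - 2) * Nat.stirlingSecond N q)
      ≤ q * ((q + 1) * Nat.stirlingSecond N (q + 1)) := by
    calc _ = Nat.stirlingSecond N q * (q * (c - 2)) := by ring
      _ ≤ _ := h2
      _ = _ := by ring
  exact Nat.le_of_mul_le_mul_left h3 hq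

theorem stirlingSecond_mul_le_succ_succ {N q c : ℕ} (hq : 1 ≤ q) (hc : (c + 1) ^ q ≤ 2 ^ N) :
    c * Nat.stirlingSecond N q ≤ Nat.stirlingSecond (N + 1) (q + 1) := by
  have h := stirlingSecond_mul_le_succ_right hq hc
  rw [Nat.stirlingSecond_succ_succ]
  rcases Nat.eq_zero_or_pos c with rfl | hc0
  · simp
  · obtain ⟨d, rfl⟩ := Nat.exists_eq_add_of_le' hc0
    have : d + 1 + 1 - 2 = d := by omega
    rw [this] at h
    rw [Nat.succ_mul]
    omega

theorem mul_stirlingSecond_le (N q : ℕ) :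
    q * Nat.stirlingSecond N q ≤ Nat.stirlingSecond (N + 1) q := by
  cases q with
  | zero => simp
  | succ q => rw [Nat.stirlingSecond_succ_succ]; omega

theorem stirlingSecond_mono_left {q : ℕ} (hq : 1 ≤ q) {N N' : ℕ} (h : N ≤ N') :
    Nat.stirlingSecond N q ≤ Nat.stirlingSecond N' q := by
  induction h with
  | refl => exact le_rfl
  | step _ ih =>
    exact ih.trans ((Nat.le_mul_of_pos_left _ hq).trans (mul_stirlingSecond_le _ _))

theorem pow_le_stirlingSecond (q d : ℕ) : q ^ d ≤ Nat.stirlingSecond (q + d) q := by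
  induction d with
  | zero => simp [Nat.stirlingSecond_self]
  | succ d ih =>
    rw [pow_succ, mul_comm, ← add_assoc]
    exact (Nat.mul_le_mul_left q ih).trans (mul_stirlingSecond_le _ _)

end BlockPartition

/-! ### Numerical consequences of the lower bound on `n` -/

namespace BlockPartition

/-- The hypothesis `n ≥ 2 L(k, t)`, for `k = t + 1 + j`, freed from logarithms. -/
theorem two_pow_ge_of_boundL {n t j : ℕ}
    (hn : 2 * boundL (t + 1 + j) t ≤ (n : ℝ)) :
    4 ^ (t + 1) * (((t + 1) * (j + 2)) ^ 2) ^ (j + 2) ≤ 2 ^ n := by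
  have hpos : (0 : ℝ) < ((t : ℝ) + 1) * (j + 2) := by positivity
  have h1 : boundL (t + 1 + j) t
      = ((t : ℝ) + 1) + ((j : ℝ) + 2) * Real.logb 2 (((t : ℝ) + 1) * (j + 2)) := by
    unfold boundL
    push_cast
    ring_nf
  rw [h1] at hn
  have h2 : (4 : ℝ) ^ (t + 1) * (((t + 1) * (j + 2)) ^ 2) ^ (j + 2)
      = (2 : ℝ) ^ (2 * (((t : ℝ) + 1)
        + ((j : ℝ) + 2) * Real.logb 2 (((t : ℝ) + 1) * (j + 2)))) := by
    have e1 : 2 * (((t : ℝ) + 1) + ((j : ℝ) + 2) * Real.logb 2 (((t : ℝ) + 1) * (j + 2)))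
        = ((2 * (t + 1) : ℕ) : ℝ)
          + Real.logb 2 (((t : ℝ) + 1) * (j + 2)) * ((2 * (j + 2) : ℕ) : ℝ) := by
      push_cast; ring
    rw [e1, Real.rpow_add two_pos, Real.rpow_natCast, Real.rpow_mul two_pos.le,
      Real.rpow_logb two_pos (by norm_num) hpos, Real.rpow_natCast, pow_mul, pow_mul]
    norm_num
  have h3 : ((4 ^ (t + 1) * (((t + 1) * (j + 2)) ^ 2) ^ (j + 2) : ℕ) : ℝ) ≤ ((2 ^ n : ℕ) : ℝ) := by
    push_cast
    rw [h2, ← Real.rpow_natCast]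
    exact Real.rpow_le_rpow_of_exponent_le one_le_two hn
  exact_mod_cast h3

theorem succ_pow_mul_sub_le (D r : ℕ) : (D + 1) ^ r * (D - r) ≤ D ^ (r + 1) := by
  induction r with
  | zero => simp
  | succ r ih =>
    rcases Nat.lt_or_ge r D with h | h
    · obtain ⟨e, rfl⟩ := Nat.exists_eq_add_of_lt h
      have h1 : r + e + 1 - r = e + 1 := by omega
      have h2 : r + e + 1 - (r + 1) = e := by omega
      rw [h1] at ih
      rw [h2]
      calc (r + e + 1 + 1) ^ (r + 1) * e
          = (r + e + 1 + 1) ^ r * ((r + e + 1 + 1) * e) := by ring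
        _ ≤ (r + e + 1 + 1) ^ r * ((r + e + 1) * (e + 1)) := by
            apply Nat.mul_le_mul_left; nlinarith
        _ = (r + e + 1) * ((r + e + 1 + 1) ^ r * (e + 1)) := by ring
        _ ≤ (r + e + 1) * (r + e + 1) ^ (r + 1) := Nat.mul_le_mul_left _ ih
        _ = _ := by ring
    · have : D - (r + 1) = 0 := by omega
      simp [this]

theorem succ_pow_le_pow_succ {D r : ℕ} (h : r < D) : (D + 1) ^ r ≤ D ^ (r + 1) :=
  (Nat.le_mul_of_pos_right _ (by omega)).trans (succ_pow_mul_sub_le D r)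

section Numeric

variable {n t j : ℕ}

theorem two_mul_le_of_two_pow_ge
    (hN : 4 ^ (t + 1) * (((t + 1) * (j + 2)) ^ 2) ^ (j + 2) ≤ 2 ^ n) :
    2 * t + 2 * j + 6 ≤ n := by
  have h1 : 2 ^ (2 * t + 2 * j + 6) ≤ 2 ^ n := by
    refine le_trans ?_ hN
    have h2 : 2 ^ 2 ≤ ((t + 1) * (j + 2)) ^ 2 :=
      Nat.pow_le_pow_left (by nlinarith) 2
    calc 2 ^ (2 * t + 2 * j + 6) = 4 ^ (t + 1) * (2 ^ 2) ^ (j + 2) := by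
          rw [← pow_mul, show (4 : ℕ) = 2 ^ 2 from rfl, ← pow_mul, ← pow_add]; congr 1; ring
      _ ≤ _ := Nat.mul_le_mul_left _ (Nat.pow_le_pow_left h2 _)
  exact (Nat.pow_le_pow_iff_right (by norm_num)).1 h1

theorem ratio_pow_le (hj : 1 ≤ j)
    (hN : 4 ^ (t + 1) * (((t + 1) * (j + 2)) ^ 2) ^ (j + 2) ≤ 2 ^ n) {i : ℕ} (hi : i + 1 ≤ j) :
    (((t + 1) * (j + 2)) ^ 2 + 1) ^ (j - i) ≤ 2 ^ (n - (t + i + 1)) := by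
  have hn := two_mul_le_of_two_pow_ge hN
  set D := ((t + 1) * (j + 2)) ^ 2 with hD
  have hDj : j + 2 ≤ D := by
    rw [hD]; nlinarith [Nat.zero_le t, Nat.zero_le j, Nat.zero_le (t * j)]
  have h1 : (D + 1) ^ (j - i) ≤ D ^ (j - i + 1) := succ_pow_le_pow_succ (by omega)
  have h2 : (D + 1) ^ (j - i) * 2 ^ (t + i + 1) ≤ 2 ^ (n - (t + i + 1)) * 2 ^ (t + i + 1) := by
    rw [← pow_add, Nat.sub_add_cancel (by omega)]
    refine le_trans ?_ hN
    have h3 : 2 ^ i ≤ D ^ i := Nat.pow_le_pow_left (by omega) i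
    have h4 : 2 ^ (t + 1) ≤ 4 ^ (t + 1) := Nat.pow_le_pow_left (by norm_num) _
    calc (D + 1) ^ (j - i) * 2 ^ (t + i + 1)
        = (D + 1) ^ (j - i) * (2 ^ (t + 1) * 2 ^ i) := by rw [← pow_add]; congr 2; omega
      _ ≤ D ^ (j - i + 1) * (4 ^ (t + 1) * D ^ i) := by gcongr
      _ = 4 ^ (t + 1) * D ^ (j + 1) := by
          rw [mul_left_comm, ← pow_add]; congr 2; omega
      _ ≤ 4 ^ (t + 1) * D ^ (j + 2) :=
          Nat.mul_le_mul_left _ (Nat.pow_le_pow_right (by omega) (by omega))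
  exact Nat.le_of_mul_le_mul_right h2 (by positivity)

/-- Fixing one more block divides the number of completions by at least
`((t + 1) (k - t + 1)) ^ 2`. -/
theorem ratio_le (hj : 1 ≤ j)
    (hN : 4 ^ (t + 1) * (((t + 1) * (j + 2)) ^ 2) ^ (j + 2) ≤ 2 ^ n) {a : ℕ} (ha : t ≤ a)
    (haj : a + 1 ≤ t + j) :
    ((t + 1) * (j + 2)) ^ 2 * Nat.stirlingSecond (n - (a + 1)) (t + 1 + j - (a + 1))
      ≤ Nat.stirlingSecond (n - a) (t + 1 + j - a) := by
  obtain ⟨i, rfl⟩ := Nat.exists_eq_add_of_le ha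
  have hn := two_mul_le_of_two_pow_ge hN
  have h := stirlingSecond_mul_le_succ_succ (q := j - i) (by omega)
    (ratio_pow_le hj hN (i := i) (by omega))
  have e1 : n - (t + i + 1) + 1 = n - (t + i) := by omega
  have e2 : t + 1 + j - (t + i + 1) = j - i := by omega
  have e3 : t + 1 + j - (t + i) = j - i + 1 := by omega
  rw [e1] at h
  rwa [e2, e3]

/-- The ratio of two Stirling numbers on the same ground set; it is weaker than `ratio_le` by a
factor of about `k - t + 1`. -/
theorem ratio_same_ground_le (hj : 2 ≤ j)
    (hN : 4 ^ (t + 1) * (((t + 1) * (j + 2)) ^ 2) ^ (j + 2) ≤ 2 ^ n) :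
    (t + 1) ^ 2 * (j + 2) * Nat.stirlingSecond (n - (t + 2)) (j - 1)
      ≤ Nat.stirlingSecond (n - (t + 2)) j := by
  have h1 := ratio_pow_le (by omega) hN (i := 1) (by omega)
  have h2 : (((t + 1) * (j + 2)) ^ 2) ^ (j - 1) ≤ 2 ^ (n - (t + 2)) :=
    (Nat.pow_le_pow_left (Nat.le_succ _) _).trans h1
  have h3 := stirlingSecond_mul_le_succ_right (by omega) h2
  rw [Nat.sub_add_cancel (by omega : 1 ≤ j)] at h3
  have h4 : j * ((t + 1) ^ 2 * (j + 2)) ≤ ((t + 1) * (j + 2)) ^ 2 - 2 := by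
    apply Nat.le_sub_of_add_le
    nlinarith [Nat.zero_le t, Nat.zero_le j, Nat.zero_le (t * j), Nat.zero_le (t ^ 2),
      Nat.zero_le (t ^ 2 * j)]
  have h5 : j * ((t + 1) ^ 2 * (j + 2) * Nat.stirlingSecond (n - (t + 2)) (j - 1))
      ≤ j * Nat.stirlingSecond (n - (t + 2)) j := by
    refine le_trans ?_ h3
    rw [← mul_assoc]
    exact Nat.mul_le_mul_right _ h4
  exact Nat.le_of_mul_le_mul_left h5 (by omega)

/-- This is what excludes families whose smallest cover has `k` blocks, where the number of
partitions containing the cover is not bounded by `S(n - k, 0) = 0`. -/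
theorem pow_le_stirling_top (hj : 2 ≤ j)
    (hN : 4 ^ (t + 1) * (((t + 1) * (j + 2)) ^ 2) ^ (j + 2) ≤ 2 ^ n) :
    ((t + 1) * (j + 2)) ^ (j + 1) ≤ Nat.stirlingSecond (n - (t + 1)) j := by
  have hn := two_mul_le_of_two_pow_ge hN
  have h1 := pow_le_stirlingSecond j (n - (t + 1) - j)
  rw [Nat.add_sub_cancel' (by omega)] at h1
  refine le_trans ?_ ((Nat.pow_le_pow_left hj _).trans h1)
  have h2 : ((t + 1) * (j + 2)) ^ (j + 1) * 2 ^ (t + 1 + j)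
      ≤ 2 ^ (n - (t + 1) - j) * 2 ^ (t + 1 + j) := by
    rw [← pow_add, show n - (t + 1) - j + (t + 1 + j) = n by omega]
    refine le_trans ?_ hN
    have hs : 2 ≤ (t + 1) * (j + 2) := by nlinarith
    have h4 : 2 ^ (t + 1) ≤ 4 ^ (t + 1) := Nat.pow_le_pow_left (by norm_num) _
    calc ((t + 1) * (j + 2)) ^ (j + 1) * 2 ^ (t + 1 + j)
        = 2 ^ (t + 1) * (((t + 1) * (j + 2)) ^ (j + 1) * 2 ^ j) := by rw [pow_add]; ring
      _ ≤ 4 ^ (t + 1) * (((t + 1) * (j + 2)) ^ (j + 1) * ((t + 1) * (j + 2)) ^ j) := by gcongr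
      _ ≤ 4 ^ (t + 1) * (((t + 1) * (j + 2)) ^ 2) ^ (j + 2) := by
          rw [← pow_add, ← pow_mul]
          exact Nat.mul_le_mul_left _ (Nat.pow_le_pow_right (by omega) (by omega))
  exact Nat.le_of_mul_le_mul_right h2 (by positivity)

theorem stirlingSecond_pos {N q : ℕ} (hq : 1 ≤ q) (h : q ≤ N) : 0 < Nat.stirlingSecond N q := by
  have h1 := pow_le_stirlingSecond q (N - q)
  rw [Nat.add_sub_cancel' h] at h1
  exact lt_of_lt_of_le (pow_pos hq _) h1

end Numeric

end BlockPartition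

/-! ### Stars, covers and heavy sets -/

namespace BlockPartition

variable {n k t : ℕ} {𝓕 : Finset (Finset (Finset (Fin n)))}

/-- The members of `𝓕` that contain all blocks of `U`. -/
def star (𝓕 : Finset (Finset (Finset (Fin n)))) (U : Finset (Finset (Fin n))) :
    Finset (Finset (Finset (Fin n))) :=
  𝓕.filter fun F => U ⊆ F

theorem mem_star {U F : Finset (Finset (Fin n))} : F ∈ star 𝓕 U ↔ F ∈ 𝓕 ∧ U ⊆ F := by
  simp [star]

theorem star_subset_star {𝓖 : Finset (Finset (Finset (Fin n)))} (h : 𝓕 ⊆ 𝓖)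
    {U V : Finset (Finset (Fin n))} (hUV : V ⊆ U) : star 𝓕 U ⊆ star 𝓖 V := fun _ hF =>
  mem_star.2 ⟨h (mem_star.1 hF).1, hUV.trans (mem_star.1 hF).2⟩

theorem card_star_kPartitions {U : Finset (Finset (Fin n))} (hU : IsPartition U)
    (hUk : U.card ≤ k) :
    (star (kPartitions n k) U).card
      = Nat.stirlingSecond (n - (support U).card) (k - U.card) := by
  have hc : ((support U)ᶜ).card = n - (support U).card := by
    rw [Finset.card_compl, Fintype.card_fin]
  rw [← hc, ← card_partitionsOf]
  refine Finset.card_nbij' (fun F => F \ U) (fun P => U ∪ P) ?_ ?_ ?_ ?_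
  · intro F hF
    obtain ⟨hF, hUF⟩ := mem_star.1 (Finset.mem_coe.1 hF)
    obtain ⟨hF, hs, hcard⟩ := mem_kPartitions.1 hF
    rw [Finset.mem_coe, mem_partitionsOf]
    refine ⟨hF.mono Finset.sdiff_subset, ?_, ?_⟩
    · ext x
      simp only [Finset.mem_compl, mem_support, Finset.mem_sdiff]
      constructor
      · rintro ⟨A, ⟨hA, hAU⟩, hx⟩ ⟨B, hB, hx'⟩
        exact hAU (hF.eq_of_mem hA (hUF hB) hx hx' ▸ hB)
      · intro h
        obtain ⟨A, hA, hx⟩ := mem_support.1 (hs ▸ Finset.mem_univ x)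
        exact ⟨A, ⟨hA, fun hAU => h ⟨A, hAU, hx⟩⟩, hx⟩
    · rw [Finset.card_sdiff_of_subset hUF, hcard]
  · intro P hP
    rw [Finset.mem_coe, mem_partitionsOf] at hP
    obtain ⟨hP, hs, hcard⟩ := hP
    have hd : Disjoint (support U) (support P) := by rw [hs]; exact disjoint_compl_right
    have hd' : Disjoint U P := by
      rw [Finset.disjoint_left]
      intro A hA hAP
      obtain ⟨x, hx⟩ := hU.1 A hA
      exact Finset.disjoint_left.1 hd (mem_support.2 ⟨A, hA, hx⟩) (mem_support.2 ⟨A, hAP, hx⟩)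
    rw [Finset.mem_coe, mem_star, mem_kPartitions]
    refine ⟨⟨isPartition_union hU hP hd, ?_, ?_⟩, Finset.subset_union_left⟩
    · rw [support_union, hs, Finset.union_compl]
    · rw [Finset.card_union_of_disjoint hd', hcard]; omega
  · intro F hF
    exact Finset.union_sdiff_of_subset (mem_star.1 (Finset.mem_coe.1 hF)).2
  · intro P hP
    rw [Finset.mem_coe, mem_partitionsOf] at hP
    obtain ⟨hP, hs, hcard⟩ := hP
    apply Finset.union_sdiff_cancel_left
    rw [Finset.disjoint_left]
    intro A hA hAP
    obtain ⟨x, hx⟩ := hU.1 A hA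
    have : x ∈ support P := mem_support.2 ⟨A, hAP, hx⟩
    rw [hs, Finset.mem_compl] at this
    exact this (mem_support.2 ⟨A, hA, hx⟩)

theorem isPartition_of_mem_star (h𝓕 : 𝓕 ⊆ kPartitions n k) {U F : Finset (Finset (Fin n))}
    (hF : F ∈ star 𝓕 U) : IsPartition U :=
  (mem_kPartitions.1 (h𝓕 (mem_star.1 hF).1)).1.mono (mem_star.1 hF).2

theorem card_star_le_of_support (h𝓕 : 𝓕 ⊆ kPartitions n k) {U : Finset (Finset (Fin n))} {a s : ℕ}
    (ha : U.card = a) (hak : a + 1 ≤ k) (hs : IsPartition U → s ≤ (support U).card) :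
    (star 𝓕 U).card ≤ Nat.stirlingSecond (n - s) (k - a) := by
  rcases (star 𝓕 U).eq_empty_or_nonempty with h | ⟨F, hF⟩
  · rw [h]; simp
  · have hU := isPartition_of_mem_star h𝓕 hF
    refine (Finset.card_le_card (star_subset_star h𝓕 subset_rfl)).trans ?_
    rw [card_star_kPartitions hU (by omega), ha]
    exact stirlingSecond_mono_left (by omega) (Nat.sub_le_sub_left (hs hU) n)

/-- The restriction `a < k` is needed: a star of `k` blocks covering the ground set has one member,
but `S(n - k, 0) = 0`. -/
theorem card_star_le (h𝓕 : 𝓕 ⊆ kPartitions n k) {U : Finset (Finset (Fin n))} {a : ℕ}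
    (ha : U.card = a) (hak : a + 1 ≤ k) :
    (star 𝓕 U).card ≤ Nat.stirlingSecond (n - a) (k - a) :=
  card_star_le_of_support h𝓕 ha hak fun hU => ha ▸ hU.card_le_card_support

theorem card_star_le_one (h𝓕 : 𝓕 ⊆ kPartitions n k) {U : Finset (Finset (Fin n))}
    (hU : U.card = k) : (star 𝓕 U).card ≤ 1 := by
  rw [Finset.card_le_one]
  have key : ∀ F ∈ star 𝓕 U, F = U := fun F hF => by
    obtain ⟨hF, hUF⟩ := mem_star.1 hF
    exact (Finset.eq_of_subset_of_card_le hUF (by rw [(mem_kPartitions.1 (h𝓕 hF)).2.2, hU])).symm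
  intro F hF G hG
  rw [key F hF, key G hG]

/-- A member of a `t`-intersecting family misses at most `k - t` blocks of another member `G`,
so it meets every `(k - t + 1)`-subset of `G`. -/
theorem exists_hitting_set (h𝓕 : 𝓕 ⊆ kPartitions n k) (hint : IsIntersecting t 𝓕)
    {U G : Finset (Finset (Fin n))} (hG : G ∈ 𝓕) (hUG : (U ∩ G).card < t) :
    ∃ E ⊆ G \ U, E.card = k - t + 1 ∧ ∀ F ∈ 𝓕, (F ∩ E).Nonempty := by
  have hGk := (mem_kPartitions.1 (h𝓕 hG)).2.2
  have h1 : k - t + 1 ≤ (G \ U).card := by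
    have := Finset.card_sdiff_add_card_inter G U
    rw [Finset.inter_comm] at this
    have h2 := hint G hG G hG
    rw [Finset.inter_self] at h2
    omega
  obtain ⟨E, hE, hEc⟩ := Finset.exists_subset_card_eq h1
  refine ⟨E, hE, hEc, fun F hF => ?_⟩
  rw [← Finset.not_disjoint_iff_nonempty_inter]
  intro hd
  have h2 := hint F hF G hG
  have h3 : F ∩ G ⊆ G \ E := fun A hA => by
    rw [Finset.mem_inter] at hA
    exact Finset.mem_sdiff.2 ⟨hA.2, fun h => Finset.disjoint_left.1 hd hA.1 h⟩
  have h4 := Finset.card_le_card h3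
  have h5 : E ⊆ G := hE.trans Finset.sdiff_subset
  rw [Finset.card_sdiff_of_subset h5, hGk, hEc] at h4
  omega

theorem star_subset_biUnion {U E : Finset (Finset (Fin n))}
    (hE : ∀ F ∈ star 𝓕 U, (F ∩ E).Nonempty) :
    star 𝓕 U ⊆ E.biUnion fun B => star 𝓕 (insert B U) := by
  intro F hF
  obtain ⟨B, hB⟩ := hE F hF
  rw [Finset.mem_inter] at hB
  obtain ⟨hF, hUF⟩ := mem_star.1 hF
  exact Finset.mem_biUnion.2 ⟨B, hB.2, mem_star.2 ⟨hF, Finset.insert_subset hB.1 hUF⟩⟩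

theorem card_star_le_of_hitting {U E : Finset (Finset (Fin n))} {M : ℕ}
    (hE : ∀ F ∈ star 𝓕 U, (F ∩ E).Nonempty)
    (hM : ∀ B ∈ E, (star 𝓕 (insert B U)).card ≤ M) : (star 𝓕 U).card ≤ E.card * M :=
  (Finset.card_le_card (star_subset_biUnion hE)).trans (Finset.card_biUnion_le_card_mul _ _ _ hM)

/-- If no set of fewer than `s` blocks is a `t`-cover, then going from a star at depth `s - d`
to stars at depth `s` costs a factor of `k - t + 1` per level. -/
theorem card_star_le_pow_mul (h𝓕 : 𝓕 ⊆ kPartitions n k) (hint : IsIntersecting t 𝓕) {s M : ℕ}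
    (hs : ∀ U : Finset (Finset (Fin n)), U.card < s → ∃ G ∈ 𝓕, (U ∩ G).card < t)
    (hM : ∀ U : Finset (Finset (Fin n)), U.card = s → (star 𝓕 U).card ≤ M) (d : ℕ) :
    ∀ U : Finset (Finset (Fin n)), U.card + d = s →
      (star 𝓕 U).card ≤ (k - t + 1) ^ d * M := by
  induction d with
  | zero =>
    intro U hU
    simpa using hM U (by omega)
  | succ d ih =>
    intro U hU
    obtain ⟨G, hG, hUG⟩ := hs U (by omega)
    obtain ⟨E, hEs, hEc, hE⟩ := exists_hitting_set h𝓕 hint hG hUG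
    rw [pow_succ', mul_assoc, ← hEc]
    refine card_star_le_of_hitting (fun F hF => hE F (mem_star.1 hF).1) fun B hB => ?_
    rw [hEc]
    apply ih
    rw [Finset.card_insert_of_notMem (Finset.mem_sdiff.1 (hEs hB)).2]
    omega

theorem subset_biUnion_of_cover {T : Finset (Finset (Fin n))}
    (hT : ∀ G ∈ 𝓕, t ≤ (T ∩ G).card) :
    𝓕 ⊆ (T.powersetCard t).biUnion fun U => star 𝓕 U := by
  intro F hF
  obtain ⟨U, hU, hUc⟩ := Finset.exists_subset_card_eq (hT F hF)
  refine Finset.mem_biUnion.2 ⟨U, Finset.mem_powersetCard.2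
    ⟨hU.trans Finset.inter_subset_left, hUc⟩, mem_star.2 ⟨hF, hU.trans Finset.inter_subset_right⟩⟩

theorem choose_add_le_pow (t d : ℕ) : (t + d).choose t ≤ (t + 1) ^ d := by
  induction d with
  | zero => simp
  | succ d ih =>
    have h1 := Nat.add_one_mul_choose_eq (t + d) d
    have h2 : (t + d).choose d = (t + d).choose t := Nat.choose_symm_add.symm
    have h3 : (t + (d + 1)).choose t = (t + d + 1).choose (d + 1) := Nat.choose_symm_add
    rw [h3]
    rw [h2] at h1
    have h4 : (t + d + 1).choose (d + 1) * (d + 1) ≤ (t + 1) ^ (d + 1) * (d + 1) := by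
      calc _ = (t + d + 1) * (t + d).choose t := h1.symm
        _ ≤ ((t + 1) * (d + 1)) * (t + 1) ^ d := Nat.mul_le_mul (by nlinarith) ih
        _ = _ := by ring
    exact Nat.le_of_mul_le_mul_right h4 (by omega)

/-- The branching bound, starting from the `t`-subsets of a smallest cover `T`. -/
theorem card_le_of_min_cover (h𝓕 : 𝓕 ⊆ kPartitions n k) (hint : IsIntersecting t 𝓕) {s M : ℕ}
    (hs : ∀ U : Finset (Finset (Fin n)), U.card < t + s → ∃ G ∈ 𝓕, (U ∩ G).card < t)
    (hM : ∀ U : Finset (Finset (Fin n)), U.card = t + s → (star 𝓕 U).card ≤ M)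
    {T : Finset (Finset (Fin n))} (hTc : T.card = t + s) (hT : ∀ G ∈ 𝓕, t ≤ (T ∩ G).card) :
    𝓕.card ≤ ((t + 1) * (k - t + 1)) ^ s * M := by
  refine (Finset.card_le_card (subset_biUnion_of_cover hT)).trans ?_
  refine (Finset.card_biUnion_le_card_mul _ _ ((k - t + 1) ^ s * M) fun U hU => ?_).trans ?_
  · exact card_star_le_pow_mul h𝓕 hint hs hM s U (by rw [(Finset.mem_powersetCard.1 hU).2])
  · rw [Finset.card_powersetCard, hTc, mul_pow, mul_assoc]
    exact Nat.mul_le_mul_right _ (choose_add_le_pow t s)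

theorem pow_mul_stirlingSecond_le {j : ℕ} (hj : 1 ≤ j)
    (hN : 4 ^ (t + 1) * (((t + 1) * (j + 2)) ^ 2) ^ (j + 2) ≤ 2 ^ n) (i : ℕ) (hi : i + 1 ≤ j) :
    (((t + 1) * (j + 2)) ^ 2) ^ i * Nat.stirlingSecond (n - (t + 1 + i)) (j - i)
      ≤ Nat.stirlingSecond (n - (t + 1)) j := by
  induction i with
  | zero => simp
  | succ i ih =>
    refine le_trans ?_ (ih (by omega))
    rw [pow_succ, mul_assoc]
    apply Nat.mul_le_mul_left
    have := ratio_le hj hN (a := t + 1 + i) (by omega) (by omega)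
    rwa [show t + 1 + j - (t + 1 + i + 1) = j - (i + 1) by omega,
      show t + 1 + j - (t + 1 + i) = j - i by omega] at this

/-- A family without a `t`-cover by `t + 1` blocks is small. -/
theorem card_le_of_no_small_cover {j : ℕ} (hj : 2 ≤ j)
    (hN : 4 ^ (t + 1) * (((t + 1) * (j + 2)) ^ 2) ^ (j + 2) ≤ 2 ^ n)
    (h𝓕 : 𝓕 ⊆ kPartitions n (t + 1 + j)) (hint : IsIntersecting t 𝓕)
    (hs : ∀ U : Finset (Finset (Fin n)), U.card ≤ t + 1 → ∃ G ∈ 𝓕, (U ∩ G).card < t) :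
    𝓕.card ≤ Nat.stirlingSecond (n - (t + 1)) j := by
  classical
  rcases 𝓕.eq_empty_or_nonempty with rfl | ⟨F, hF⟩
  · simp
  have hex : ∃ τ, ∃ T : Finset (Finset (Fin n)), T.card = τ ∧ ∀ G ∈ 𝓕, t ≤ (T ∩ G).card :=
    ⟨_, F, rfl, fun G hG => hint F hF G hG⟩
  obtain ⟨T, hTc, hT⟩ := Nat.find_spec hex
  have hmin : ∀ U : Finset (Finset (Fin n)), U.card < Nat.find hex →
      ∃ G ∈ 𝓕, (U ∩ G).card < t := by
    intro U hU
    by_contra! h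
    exact Nat.find_min hex hU ⟨U, rfl, h⟩
  have hle : Nat.find hex ≤ t + 1 + j :=
    (mem_kPartitions.1 (h𝓕 hF)).2.2 ▸ Nat.find_min' hex ⟨F, rfl, fun G hG => hint F hF G hG⟩
  have hge : t + 2 ≤ Nat.find hex := by
    by_contra! h
    obtain ⟨G, hG, hlt⟩ := hs T (by omega)
    exact absurd (hT G hG) (by omega)
  obtain ⟨i, hi⟩ := Nat.exists_eq_add_of_le hge
  rw [hi] at hTc hmin hle
  rw [show t + 2 + i = t + (i + 2) by ring] at hTc hmin
  have hm : t + 1 + j - t + 1 = j + 2 := by omega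
  rcases Nat.lt_or_ge (i + 1) j with hij | hij
  · have h1 := card_le_of_min_cover h𝓕 hint hmin
      (fun U hU => card_star_le h𝓕 hU (by omega)) hTc hT
    rw [hm] at h1
    have h2 := pow_mul_stirlingSecond_le (by omega) hN (i + 1) (by omega)
    refine h1.trans (le_trans ?_ h2)
    rw [show t + (i + 2) = t + 1 + (i + 1) by ring,
      show t + 1 + j - (t + 1 + (i + 1)) = j - (i + 1) by omega, ← pow_mul]
    exact Nat.mul_le_mul_right _ (Nat.pow_le_pow_right (by positivity) (by omega))
  · obtain rfl : i + 1 = j := by omega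
    have h1 := card_le_of_min_cover h𝓕 hint hmin
      (fun U hU => card_star_le_one h𝓕 (by rw [hU]; ring)) hTc hT
    rw [hm, mul_one] at h1
    exact h1.trans (pow_le_stirling_top hj hN)

/-- The sets of `t + 1` blocks whose star has more than `c` members. -/
def heavySets (t c : ℕ) (𝓕 : Finset (Finset (Finset (Fin n)))) :
    Finset (Finset (Finset (Fin n))) :=
  Finset.univ.filter fun T => T.card = t + 1 ∧ c < (star 𝓕 T).card

theorem mem_heavySets {c : ℕ} {T : Finset (Finset (Fin n))} :
    T ∈ heavySets t c 𝓕 ↔ T.card = t + 1 ∧ c < (star 𝓕 T).card := by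
  simp [heavySets]

theorem isPartition_of_mem_heavySets (h𝓕 : 𝓕 ⊆ kPartitions n k) {c : ℕ}
    {T : Finset (Finset (Fin n))} (hT : T ∈ heavySets t c 𝓕) : IsPartition T := by
  obtain ⟨F, hF⟩ := Finset.card_pos.1 (Nat.zero_lt_of_lt (mem_heavySets.1 hT).2)
  exact isPartition_of_mem_star h𝓕 hF

/-- A heavy set is a `t`-cover: otherwise its star splits into `k - t + 1` stars of sets of
`t + 2` blocks. -/
theorem le_card_inter_of_mem_heavySets (h𝓕 : 𝓕 ⊆ kPartitions n k) (hint : IsIntersecting t 𝓕)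
    (hk : t + 3 ≤ k) {c : ℕ}
    (hc : (k - t + 1) * Nat.stirlingSecond (n - (t + 2)) (k - (t + 2)) ≤ c)
    {T G : Finset (Finset (Fin n))} (hT : T ∈ heavySets t c 𝓕) (hG : G ∈ 𝓕) :
    t ≤ (T ∩ G).card := by
  by_contra! h
  obtain ⟨hTc, hTs⟩ := mem_heavySets.1 hT
  obtain ⟨E, hEs, hEc, hE⟩ := exists_hitting_set h𝓕 hint hG h
  have := card_star_le_of_hitting (U := T) (fun F hF => hE F (mem_star.1 hF).1)
    (fun B hB => card_star_le h𝓕 (a := t + 2) (by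
      rw [Finset.card_insert_of_notMem (Finset.mem_sdiff.1 (hEs hB)).2, hTc]) (by omega))
  rw [hEc] at this
  omega

/-- Two heavy sets share `t` blocks: otherwise every member containing the first one contains a
further block of the second one, and there are too few of these. -/
theorem le_card_inter_of_heavySets (h𝓕 : 𝓕 ⊆ kPartitions n k) (hint : IsIntersecting t 𝓕)
    (hk : t + 3 ≤ k) {c : ℕ}
    (hc : (k - t + 1) * Nat.stirlingSecond (n - (t + 2)) (k - (t + 2)) ≤ c)
    (hc' : (t + 1) * Nat.stirlingSecond (n - (t + 2)) (k - (t + 2)) ≤ c)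
    {T T' : Finset (Finset (Fin n))} (hT : T ∈ heavySets t c 𝓕) (hT' : T' ∈ heavySets t c 𝓕) :
    t ≤ (T ∩ T').card := by
  by_contra! h
  obtain ⟨hTc, hTs⟩ := mem_heavySets.1 hT
  have h1 : ∀ F ∈ star 𝓕 T, (F ∩ (T' \ T)).Nonempty := by
    intro F hF
    have h2 := le_card_inter_of_mem_heavySets h𝓕 hint hk hc hT' (mem_star.1 hF).1
    by_contra hne
    have h3 : T' ∩ F ⊆ T ∩ T' := fun A hA => by
      rw [Finset.mem_inter] at hA
      refine Finset.mem_inter.2 ⟨?_, hA.1⟩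
      by_contra hAT
      exact hne ⟨A, Finset.mem_inter.2 ⟨hA.2, Finset.mem_sdiff.2 ⟨hA.1, hAT⟩⟩⟩
    have := Finset.card_le_card h3
    omega
  have h2 := card_star_le_of_hitting h1 (fun B hB => card_star_le h𝓕 (a := t + 2) (by
      rw [Finset.card_insert_of_notMem (Finset.mem_sdiff.1 hB).2, hTc]) (by omega))
  have h3 : (T' \ T).card ≤ t + 1 :=
    (Finset.card_le_card Finset.sdiff_subset).trans (mem_heavySets.1 hT').1.le
  have := Nat.mul_le_mul_right (Nat.stirlingSecond (n - (t + 2)) (k - (t + 2))) h3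
  omega

/-- If `t` blocks never form a `t`-cover but some `t + 1` blocks do, all but few members contain
a heavy set. -/
theorem card_le_card_heavy_add (h𝓕 : 𝓕 ⊆ kPartitions n k) (hint : IsIntersecting t 𝓕) {c : ℕ}
    (hnt : ∀ U : Finset (Finset (Fin n)), U.card = t → ∃ G ∈ 𝓕, (U ∩ G).card < t)
    {T : Finset (Finset (Fin n))} (hTc : T.card = t + 1) (hT : ∀ G ∈ 𝓕, t ≤ (T ∩ G).card) :
    𝓕.card ≤ ((heavySets t c 𝓕).biUnion (star 𝓕)).card + (t + 1) * ((k - t + 1) * c) := by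
  have h1 : 𝓕 ⊆ (heavySets t c 𝓕).biUnion (star 𝓕) ∪
      (T.powersetCard t).biUnion
        fun U => star 𝓕 U \ (heavySets t c 𝓕).biUnion (star 𝓕) := by
    intro F hF
    by_cases h : F ∈ (heavySets t c 𝓕).biUnion (star 𝓕)
    · exact Finset.mem_union_left _ h
    · obtain ⟨U, hU, hFU⟩ := Finset.mem_biUnion.1 (subset_biUnion_of_cover hT hF)
      exact Finset.mem_union_right _
        (Finset.mem_biUnion.2 ⟨U, hU, Finset.mem_sdiff.2 ⟨hFU, h⟩⟩)
  refine (Finset.card_le_card h1).trans ((Finset.card_union_le _ _).trans ?_)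
  apply Nat.add_le_add_left
  have h2 : (T.powersetCard t).card = t + 1 := by
    rw [Finset.card_powersetCard, hTc, Nat.choose_succ_self_right]
  rw [← h2]
  refine Finset.card_biUnion_le_card_mul _ _ _ fun U hU => ?_
  have hUc := (Finset.mem_powersetCard.1 hU).2
  obtain ⟨G, hG, hUG⟩ := hnt U hUc
  obtain ⟨E, hEs, hEc, hE⟩ := exists_hitting_set h𝓕 hint hG hUG
  have h3 : star 𝓕 U \ (heavySets t c 𝓕).biUnion (star 𝓕) ⊆
      E.biUnion fun B =>
        star 𝓕 (insert B U) \ (heavySets t c 𝓕).biUnion (star 𝓕) := by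
    intro F hF
    obtain ⟨hF, hFn⟩ := Finset.mem_sdiff.1 hF
    obtain ⟨B, hB, hFB⟩ := Finset.mem_biUnion.1
      (star_subset_biUnion (fun F hF => hE F (mem_star.1 hF).1) hF)
    exact Finset.mem_biUnion.2 ⟨B, hB, Finset.mem_sdiff.2 ⟨hFB, hFn⟩⟩
  refine (Finset.card_le_card h3).trans ?_
  rw [← hEc]
  refine Finset.card_biUnion_le_card_mul _ _ _ fun B hB => ?_
  by_cases hheavy : insert B U ∈ heavySets t c 𝓕
  · rw [Finset.sdiff_eq_empty_iff_subset.2 (Finset.subset_biUnion_of_mem (star 𝓕) hheavy)]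
    simp
  · refine (Finset.card_le_card Finset.sdiff_subset).trans ?_
    by_contra! hlt
    exact hheavy (mem_heavySets.2 ⟨by
      rw [Finset.card_insert_of_notMem (Finset.mem_sdiff.1 (hEs hB)).2, hUc], hlt⟩)

end BlockPartition

/-! ### The families `familyA` and `meetingFamily` -/

namespace BlockPartition

variable {n k t : ℕ} {𝓕 : Finset (Finset (Finset (Fin n)))}

/-- A family of `(t + 1)`-sets meeting pairwise in `t` elements either has `t` common elements or
contains three members inside a `(t + 2)`-set. -/
theorem exists_common_or_three {α : Type*} [DecidableEq α] {𝒯 : Finset (Finset α)}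
    (hc : ∀ T ∈ 𝒯, T.card = t + 1) (hint : ∀ T ∈ 𝒯, ∀ T' ∈ 𝒯, t ≤ (T ∩ T').card)
    (h2 : 2 ≤ 𝒯.card) :
    (∃ X : Finset α, X.card = t ∧ ∀ T ∈ 𝒯, X ⊆ T) ∨
      ∃ T₁ ∈ 𝒯, ∃ T₂ ∈ 𝒯, ∃ x ∈ T₁ ∩ T₂, (T₁ ∪ T₂).card = t + 2 ∧ (T₁ ∪ T₂).erase x ∈ 𝒯 := by
  obtain ⟨T₁, h₁, T₂, h₂, hne⟩ := Finset.one_lt_card.1 h2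
  have hX : (T₁ ∩ T₂).card = t := by
    apply le_antisymm _ (hint _ h₁ _ h₂)
    by_contra! h
    have e1 : T₁ ∩ T₂ = T₁ :=
      Finset.eq_of_subset_of_card_le Finset.inter_subset_left (by rw [hc _ h₁]; omega)
    have e2 : T₁ ∩ T₂ = T₂ :=
      Finset.eq_of_subset_of_card_le Finset.inter_subset_right (by rw [hc _ h₂]; omega)
    exact hne (e1.symm.trans e2)
  have hZ : (T₁ ∪ T₂).card = t + 2 := by
    have := Finset.card_union_add_card_inter T₁ T₂
    rw [hX, hc _ h₁, hc _ h₂] at this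
    omega
  by_cases hall : ∀ T ∈ 𝒯, T₁ ∩ T₂ ⊆ T
  · exact Or.inl ⟨_, hX, hall⟩
  · right
    push Not at hall
    obtain ⟨T₃, h₃, hs⟩ := hall
    obtain ⟨x, hx, hx3⟩ := Finset.not_subset.1 hs
    have key : ∀ T ∈ 𝒯, x ∈ T → T.erase x ⊆ T₃ := by
      intro T hT hxT
      have h5 : T ∩ T₃ ⊆ T.erase x := fun y hy => by
        rw [Finset.mem_inter] at hy
        exact Finset.mem_erase.2 ⟨fun h => hx3 (h ▸ hy.2), hy.1⟩
      have h6 := Finset.eq_of_subset_of_card_le h5 (by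
        rw [Finset.card_erase_of_mem hxT, hc _ hT]; exact hint _ hT _ h₃)
      rw [← h6]
      exact Finset.inter_subset_right
    refine ⟨T₁, h₁, T₂, h₂, x, hx, hZ, ?_⟩
    rw [Finset.mem_inter] at hx
    have h7 : (T₁ ∪ T₂).erase x ⊆ T₃ := by
      rw [Finset.erase_union_distrib]
      exact Finset.union_subset (key _ h₁ hx.1) (key _ h₂ hx.2)
    rwa [Finset.eq_of_subset_of_card_le h7 (by
      rw [Finset.card_erase_of_mem (Finset.mem_union_left _ hx.1), hZ, hc _ h₃]; omega)]

/-- A set `F` missing two elements of `Z = T₁ ∪ T₂` cannot meet all three of `T₁`, `T₂` and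
`Z \ {x}` in `t` elements. -/
theorem add_one_le_card_inter_of_three {α : Type*} [DecidableEq α] {T₁ T₂ F : Finset α}
    (hc : T₁.card = t + 1) (hc' : T₂.card = t + 1) (hZ : (T₁ ∪ T₂).card = t + 2) {x : α}
    (hx : x ∈ T₁ ∩ T₂) (h₁ : t ≤ (T₁ ∩ F).card) (h₂ : t ≤ (T₂ ∩ F).card)
    (h₃ : t ≤ ((T₁ ∪ T₂).erase x ∩ F).card) : t + 1 ≤ (F ∩ (T₁ ∪ T₂)).card := by
  by_contra! h
  have key : ∀ T ⊆ T₁ ∪ T₂, t ≤ (T ∩ F).card → F ∩ (T₁ ∪ T₂) ⊆ T := by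
    intro T hT hTF
    have e : T ∩ F = F ∩ (T₁ ∪ T₂) := Finset.eq_of_subset_of_card_le (by
      rw [Finset.inter_comm]; exact Finset.inter_subset_inter_left hT) (by omega)
    rw [← e]
    exact Finset.inter_subset_left
  have k1 := key _ Finset.subset_union_left h₁
  have k2 := key _ Finset.subset_union_right h₂
  have k3 := key _ (Finset.erase_subset _ _) h₃
  have hsub : F ∩ (T₁ ∪ T₂) ⊆ (T₁ ∩ T₂).erase x := fun y hy =>
    Finset.mem_erase.2 ⟨(Finset.mem_erase.1 (k3 hy)).1, Finset.mem_inter.2 ⟨k1 hy, k2 hy⟩⟩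
  have h4 := Finset.card_le_card hsub
  rw [Finset.card_erase_of_mem hx] at h4
  have h5 := Finset.card_union_add_card_inter T₁ T₂
  have h6 : t ≤ (F ∩ (T₁ ∪ T₂)).card := by
    refine h₁.trans (Finset.card_le_card ?_)
    rw [Finset.inter_comm]
    exact Finset.inter_subset_inter_left Finset.subset_union_left
  have h7 : 0 < (T₁ ∩ T₂).card := Finset.card_pos.2 ⟨x, hx⟩
  omega

theorem isPartition_union_of_three {T₁ T₂ : Finset (Finset (Fin n))} (h₁ : IsPartition T₁)
    (h₂ : IsPartition T₂) {x : Finset (Fin n)} (hx : x ∈ T₁ ∩ T₂)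
    (h₃ : IsPartition ((T₁ ∪ T₂).erase x)) : IsPartition (T₁ ∪ T₂) := by
  rw [Finset.mem_inter] at hx
  refine ⟨fun A hA => ?_, fun A hA B hB hAB => ?_⟩
  · rcases Finset.mem_union.1 hA with hA | hA
    exacts [h₁.1 A hA, h₂.1 A hA]
  · by_cases hAx : A = x
    · subst hAx
      rcases Finset.mem_union.1 hB with hB | hB
      exacts [h₁.2 _ hx.1 _ hB hAB, h₂.2 _ hx.2 _ hB hAB]
    · by_cases hBx : B = x
      · subst hBx
        rcases Finset.mem_union.1 hA with hA | hA
        exacts [h₁.2 _ hA _ hx.1 hAB, h₂.2 _ hA _ hx.2 hAB]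
      · exact h₃.2 _ (Finset.mem_erase.2 ⟨hAx, hA⟩) _ (Finset.mem_erase.2 ⟨hBx, hB⟩) hAB

theorem familyA_isIntersecting {Z : Finset (Finset (Fin n))} (hZ : Z.card = t + 2) :
    IsIntersecting t (familyA n k t Z) := by
  intro P hP Q hQ
  have h1 := (Finset.mem_filter.1 hP).2
  have h2 := (Finset.mem_filter.1 hQ).2
  have h3 := Finset.card_union_add_card_inter (P ∩ Z) (Q ∩ Z)
  have h4 : (P ∩ Z ∪ Q ∩ Z).card ≤ t + 2 := hZ ▸ Finset.card_le_card
    (Finset.union_subset Finset.inter_subset_right Finset.inter_subset_right)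
  have h5 : (P ∩ Z ∩ (Q ∩ Z)).card ≤ (P ∩ Q).card := Finset.card_le_card
    (Finset.inter_subset_inter Finset.inter_subset_left Finset.inter_subset_left)
  omega

theorem card_familyA_le {Z : Finset (Finset (Fin n))} (hZ : Z.card = t + 2) (hk : t + 2 ≤ k) :
    (familyA n k t Z).card
      ≤ (t + 2) * Nat.stirlingSecond (n - (t + 1)) (k - (t + 1)) := by
  have h1 : familyA n k t Z ⊆ (Z.powersetCard (t + 1)).biUnion (star (kPartitions n k)) := by
    intro F hF
    obtain ⟨hF, hFZ⟩ := Finset.mem_filter.1 hF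
    obtain ⟨U, hU, hUc⟩ := Finset.exists_subset_card_eq hFZ
    exact Finset.mem_biUnion.2 ⟨U, Finset.mem_powersetCard.2
      ⟨hU.trans Finset.inter_subset_right, hUc⟩, mem_star.2 ⟨hF, hU.trans Finset.inter_subset_left⟩⟩
  refine (Finset.card_le_card h1).trans ((Finset.card_biUnion_le_card_mul _ _ _ fun U hU =>
    card_star_le subset_rfl (Finset.mem_powersetCard.1 hU).2 (by omega)).trans ?_)
  rw [Finset.card_powersetCard, hZ, Nat.choose_succ_self_right]

theorem IsMaximalIntersecting.eq_of_subset (hmax : IsMaximalIntersecting n k t 𝓕)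
    {𝓖 : Finset (Finset (Finset (Fin n)))} (h : 𝓕 ⊆ 𝓖) (h𝓖 : 𝓖 ⊆ kPartitions n k)
    (hint : IsIntersecting t 𝓖) : 𝓕 = 𝓖 :=
  h.antisymm (hmax.2 ⟨h𝓖, hint⟩ h)

/-- The `k`-partitions that contain `X` and some block of `𝓑`. -/
def meetingFamily (n k : ℕ) (X 𝓑 : Finset (Finset (Fin n))) : Finset (Finset (Finset (Fin n))) :=
  (kPartitions n k).filter fun F => X ⊆ F ∧ (F ∩ 𝓑).Nonempty

theorem mem_meetingFamily {X 𝓑 F : Finset (Finset (Fin n))} :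
    F ∈ meetingFamily n k X 𝓑 ↔ F ∈ kPartitions n k ∧ X ⊆ F ∧ (F ∩ 𝓑).Nonempty := by
  simp [meetingFamily]

theorem card_meetingFamily_le_mul {X 𝓑 : Finset (Finset (Fin n))} {M : ℕ}
    (hM : ∀ B ∈ 𝓑, (star (kPartitions n k) (insert B X)).card ≤ M) :
    (meetingFamily n k X 𝓑).card ≤ 𝓑.card * M := by
  refine (Finset.card_le_card fun F hF => ?_).trans (Finset.card_biUnion_le_card_mul 𝓑
    (fun B => star (kPartitions n k) (insert B X)) M hM)
  obtain ⟨hF, hX, B, hB⟩ := mem_meetingFamily.1 hF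
  rw [Finset.mem_inter] at hB
  exact Finset.mem_biUnion.2 ⟨B, hB.2, mem_star.2 ⟨hF, Finset.insert_subset hB.1 hX⟩⟩

/-- Sets of `t + 1` blocks with a common `t`-subset `X` correspond to the set `𝓑` of their
remaining blocks. -/
theorem exists_blocks_of_common {𝒯 : Finset (Finset (Finset (Fin n)))}
    {X : Finset (Finset (Fin n))} (hX : X.card = t) (hc : ∀ T ∈ 𝒯, T.card = t + 1)
    (hXT : ∀ T ∈ 𝒯, X ⊆ T) :
    ∃ 𝓑 : Finset (Finset (Fin n)), Disjoint X 𝓑 ∧ 𝓑.card = 𝒯.card ∧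
      ∀ B, B ∈ 𝓑 ↔ B ∉ X ∧ insert B X ∈ 𝒯 := by
  have hex : ∀ T ∈ 𝒯, ∃ B, B ∉ X ∧ insert B X = T := by
    intro T hT
    have h1 : (T \ X).card = 1 := by
      rw [Finset.card_sdiff_of_subset (hXT T hT), hc T hT, hX]; omega
    obtain ⟨B, hB⟩ := Finset.card_eq_one.1 h1
    refine ⟨B, (Finset.mem_sdiff.1 (hB ▸ Finset.mem_singleton_self B)).2, ?_⟩
    rw [Finset.insert_eq, ← hB, Finset.sdiff_union_of_subset (hXT T hT)]
  choose! g hg using hex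
  refine ⟨𝒯.image g, ?_, Finset.card_image_of_injOn fun T hT T' hT' h => ?_, fun B => ?_⟩
  · rw [Finset.disjoint_right]
    intro B hB
    obtain ⟨T, hT, rfl⟩ := Finset.mem_image.1 hB
    exact (hg T hT).1
  · rw [← (hg T hT).2, ← (hg T' hT').2, h]
  · rw [Finset.mem_image]
    constructor
    · rintro ⟨T, hT, rfl⟩
      exact ⟨(hg T hT).1, by rw [(hg T hT).2]; exact hT⟩
    · rintro ⟨hB, hT⟩
      refine ⟨_, hT, ?_⟩
      have h1 := (hg _ hT).2
      have h2 : g (insert B X) ∈ insert B X := by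
        have h3 := Finset.mem_insert_self (g (insert B X)) X
        rwa [h1] at h3
      exact (Finset.mem_insert.1 h2).resolve_right (hg _ hT).1

end BlockPartition

/-! ### Heavy sets with a common part and the families `familyH` -/

namespace BlockPartition

variable {n k t : ℕ} {𝓕 : Finset (Finset (Finset (Fin n)))} {X 𝓑 : Finset (Finset (Fin n))}

theorem mem_of_cover_of_not_subset (hX : X.card = t) {G : Finset (Finset (Fin n))}
    (hXG : ¬ X ⊆ G) {B : Finset (Fin n)} (hcov : t ≤ (insert B X ∩ G).card) :
    B ∈ G ∧ (X ∩ G).card + 1 = t := by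
  have h1 : (X ∩ G).card < t := by
    rw [← hX]
    refine Finset.card_lt_card ⟨Finset.inter_subset_left, fun h => hXG ?_⟩
    exact h.trans Finset.inter_subset_right
  have hB : B ∈ G := by
    by_contra hB
    rw [Finset.insert_inter_of_notMem hB] at hcov
    omega
  rw [Finset.insert_inter_of_mem hB] at hcov
  have := Finset.card_insert_le B (X ∩ G)
  exact ⟨hB, by omega⟩

/-- The members outside the meeting family either contain `X` and one of the at most
`k - t + 1 - |𝓑|` blocks of `G` outside `X ∪ 𝓑`, or contain `𝓑` and all but one block of `X`. -/
theorem card_le_card_meetingFamily_add (h𝓕 : 𝓕 ⊆ kPartitions n k) (hint : IsIntersecting t 𝓕)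
    (hk : t + 3 ≤ k) {c : ℕ} (hX : X.card = t) (hd : Disjoint X 𝓑) (hB3 : 3 ≤ 𝓑.card)
    (hcov : ∀ B ∈ 𝓑, ∀ G ∈ 𝓕, t ≤ (insert B X ∩ G).card)
    (hlight : ∀ B, B ∉ X → B ∉ 𝓑 → (star 𝓕 (insert B X)).card ≤ c)
    {G : Finset (Finset (Fin n))} (hG : G ∈ 𝓕) (hXG : ¬ X ⊆ G) :
    𝓕.card ≤ (meetingFamily n k X 𝓑).card + ((k - t + 1 - 𝓑.card) * c
      + t * Nat.stirlingSecond (n - (t + 2)) (k - (t + 2))) := by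
  obtain ⟨𝓑', h𝓑', h𝓑'c⟩ := Finset.exists_subset_card_eq hB3
  have h𝓑G : 𝓑 ⊆ G := fun B hB => (mem_of_cover_of_not_subset hX hXG (hcov B hB G hG)).1
  have h1 : 𝓕 ⊆ meetingFamily n k X 𝓑 ∪
      (((G \ X) \ 𝓑).biUnion (fun B => star 𝓕 (insert B X)) ∪
        X.biUnion fun A => star 𝓕 (X.erase A ∪ 𝓑')) := by
    intro F hF
    by_cases hXF : X ⊆ F
    · by_cases hFB : (F ∩ 𝓑).Nonempty
      · exact Finset.mem_union_left _ (mem_meetingFamily.2 ⟨h𝓕 hF, hXF, hFB⟩)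
      · refine Finset.mem_union_right _ (Finset.mem_union_left _ ?_)
        have h2 : ((F ∩ G) \ X).Nonempty := by
          by_contra hne
          rw [Finset.not_nonempty_iff_eq_empty, Finset.sdiff_eq_empty_iff_subset] at hne
          have h3 : F ∩ G ⊆ X ∩ G := fun A hA =>
            Finset.mem_inter.2 ⟨hne hA, (Finset.mem_inter.1 hA).2⟩
          have h4 := (Finset.card_le_card h3)
          obtain ⟨B, hB⟩ := Finset.card_pos.1 (show 0 < 𝓑.card by omega)
          have h5 := (mem_of_cover_of_not_subset hX hXG (hcov B hB G hG)).2
          have h6 := hint F hF G hG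
          omega
        obtain ⟨B, hB⟩ := h2
        rw [Finset.mem_sdiff, Finset.mem_inter] at hB
        refine Finset.mem_biUnion.2 ⟨B, Finset.mem_sdiff.2 ⟨Finset.mem_sdiff.2 ⟨hB.1.2, hB.2⟩,
          fun h => hFB ⟨B, Finset.mem_inter.2 ⟨hB.1.1, h⟩⟩⟩,
          mem_star.2 ⟨hF, Finset.insert_subset hB.1.1 hXF⟩⟩
    · refine Finset.mem_union_right _ (Finset.mem_union_right _ ?_)
      have h2 : 𝓑 ⊆ F := fun B hB => (mem_of_cover_of_not_subset hX hXF (hcov B hB F hF)).1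
      obtain ⟨B, hB⟩ := Finset.card_pos.1 (show 0 < 𝓑.card by omega)
      have h5 := (mem_of_cover_of_not_subset hX hXF (hcov B hB F hF)).2
      obtain ⟨A, hA, hAF⟩ := Finset.not_subset.1 hXF
      have h6 : X ∩ F = X.erase A := Finset.eq_of_subset_of_card_le (fun C hC => by
        rw [Finset.mem_inter] at hC
        exact Finset.mem_erase.2 ⟨fun h => hAF (h ▸ hC.2), hC.1⟩) (by
        rw [Finset.card_erase_of_mem hA]; omega)
      exact Finset.mem_biUnion.2 ⟨A, hA, mem_star.2 ⟨hF, Finset.union_subset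
        (h6 ▸ Finset.inter_subset_right) (h𝓑'.trans h2)⟩⟩
  refine (Finset.card_le_card h1).trans ((Finset.card_union_le _ _).trans ?_)
  refine Nat.add_le_add_left ((Finset.card_union_le _ _).trans (Nat.add_le_add ?_ ?_)) _
  · have h2 : ((G \ X) \ 𝓑).card = k - t + 1 - 𝓑.card := by
      obtain ⟨B, hB⟩ := Finset.card_pos.1 (show 0 < 𝓑.card by omega)
      have h5 := (mem_of_cover_of_not_subset hX hXG (hcov B hB G hG)).2
      have h6 := Finset.card_sdiff_add_card_inter G X
      rw [Finset.inter_comm, (mem_kPartitions.1 (h𝓕 hG)).2.2] at h6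
      rw [Finset.card_sdiff_of_subset (Finset.subset_sdiff.2 ⟨h𝓑G, hd.symm⟩)]
      omega
    rw [← h2]
    exact Finset.card_biUnion_le_card_mul _ _ _ fun B hB =>
      hlight B (Finset.mem_sdiff.1 (Finset.mem_sdiff.1 hB).1).2 (Finset.mem_sdiff.1 hB).2
  · have h7 : X.card * Nat.stirlingSecond (n - (t + 2)) (k - (t + 2))
      = t * Nat.stirlingSecond (n - (t + 2)) (k - (t + 2)) := by rw [hX]
    rw [← h7]
    refine Finset.card_biUnion_le_card_mul _ _ _ fun A hA => card_star_le h𝓕 ?_ (by omega)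
    rw [Finset.card_union_of_disjoint (hd.mono (Finset.erase_subset _ _) h𝓑'),
      Finset.card_erase_of_mem hA, hX, h𝓑'c]
    have := Finset.card_pos.2 ⟨A, hA⟩
    omega

theorem isPartition_union_of_cover (h𝓕 : 𝓕 ⊆ kPartitions n k) (hX : X.card = t)
    (hne : 𝓑.Nonempty) (hcov : ∀ B ∈ 𝓑, ∀ G ∈ 𝓕, t ≤ (insert B X ∩ G).card)
    (hpart : ∀ B ∈ 𝓑, IsPartition (insert B X))
    {G : Finset (Finset (Fin n))} (hG : G ∈ 𝓕) (hXG : ¬ X ⊆ G) : IsPartition (X ∪ 𝓑) := by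
  have h𝓑G : 𝓑 ⊆ G := fun B hB => (mem_of_cover_of_not_subset hX hXG (hcov B hB G hG)).1
  have hGp := (mem_kPartitions.1 (h𝓕 hG)).1.mono h𝓑G
  obtain ⟨B₀, hB₀⟩ := hne
  have hXp : IsPartition X := (hpart B₀ hB₀).mono (Finset.subset_insert _ _)
  refine ⟨fun A hA => ?_, fun A hA B hB hAB => ?_⟩
  · rcases Finset.mem_union.1 hA with hA | hA
    exacts [hXp.1 A hA, hGp.1 A hA]
  · rcases Finset.mem_union.1 hA with hA | hA <;> rcases Finset.mem_union.1 hB with hB | hB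
    · exact hXp.2 _ hA _ hB hAB
    · exact (hpart B hB).2 _ (Finset.mem_insert_of_mem hA) _ (Finset.mem_insert_self _ _) hAB
    · exact (hpart A hA).2 _ (Finset.mem_insert_self _ _) _ (Finset.mem_insert_of_mem hB) hAB
    · exact hGp.2 _ hA _ hB hAB

/-- There are at most `k - t` blocks in `𝓑`: a member `G` not containing `X` contains `𝓑` and
`t - 1` blocks of `X`, and it needs one more block to cover the remaining block of `X`. -/
theorem card_blocks_le (h𝓕 : 𝓕 ⊆ kPartitions n k) (hX : X.card = t)
    (hne : 𝓑.Nonempty) (hd : Disjoint X 𝓑)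
    (hcov : ∀ B ∈ 𝓑, ∀ G ∈ 𝓕, t ≤ (insert B X ∩ G).card)
    (hpart : ∀ B ∈ 𝓑, IsPartition (insert B X))
    {G : Finset (Finset (Fin n))} (hG : G ∈ 𝓕) (hXG : ¬ X ⊆ G) : 𝓑.card + t ≤ k := by
  have hp := isPartition_union_of_cover h𝓕 hX hne hcov hpart hG hXG
  have h𝓑G : 𝓑 ⊆ G := fun B hB => (mem_of_cover_of_not_subset hX hXG (hcov B hB G hG)).1
  obtain ⟨B₀, hB₀⟩ := hne
  have hXc := (mem_of_cover_of_not_subset hX hXG (hcov B₀ hB₀ G hG)).2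
  obtain ⟨hGp, hGs, hGk⟩ := mem_kPartitions.1 (h𝓕 hG)
  by_contra! hlt
  have h1 : X ∩ G ∪ 𝓑 = G := Finset.eq_of_subset_of_card_le
    (Finset.union_subset Finset.inter_subset_right h𝓑G) (by
      rw [Finset.card_union_of_disjoint (hd.mono_left Finset.inter_subset_left)]; omega)
  obtain ⟨A, hA, hAG⟩ := Finset.not_subset.1 hXG
  obtain ⟨y, hy⟩ := hp.1 A (Finset.mem_union_left _ hA)
  obtain ⟨C, hC, hyC⟩ := mem_support.1 (hGs ▸ Finset.mem_univ y)
  have hC' : C ∈ X ∪ 𝓑 := by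
    rw [← h1] at hC
    exact Finset.union_subset_union_left Finset.inter_subset_left hC
  have := hp.eq_of_mem (Finset.mem_union_left _ hA) hC' hy hyC
  exact hAG (this ▸ hC)

theorem union_sdiff_left_of_disjoint (hd : Disjoint X 𝓑) : (X ∪ 𝓑) \ X = 𝓑 :=
  Finset.union_sdiff_cancel_left hd

theorem familyH_union (hd : Disjoint X 𝓑) : familyH n k X (X ∪ 𝓑) =
    meetingFamily n k X 𝓑 ∪
      X.image fun B => ((X ∪ 𝓑) \ {B}) ∪ {B ∪ (support (X ∪ 𝓑))ᶜ} := by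
  rw [familyH, union_sdiff_left_of_disjoint hd]; rfl

theorem card_familyH_le (hd : Disjoint X 𝓑) (hX : X.card = t) :
    (familyH n k X (X ∪ 𝓑)).card ≤ (meetingFamily n k X 𝓑).card + t := by
  rw [familyH_union hd, ← hX]
  exact (Finset.card_union_le _ _).trans (Nat.add_le_add_left Finset.card_image_le _)

theorem familyH_subset_kPartitions (hd : Disjoint X 𝓑) (hp : IsPartition (X ∪ 𝓑))
    (hc : (X ∪ 𝓑).card = k) : familyH n k X (X ∪ 𝓑) ⊆ kPartitions n k := by
  rw [familyH_union hd]
  refine Finset.union_subset (Finset.filter_subset _ _) fun G hG => ?_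
  obtain ⟨A, hA, rfl⟩ := Finset.mem_image.1 hG
  have hAM : A ∈ X ∪ 𝓑 := Finset.mem_union_left _ hA
  have hA0 : (A ∪ (support (X ∪ 𝓑))ᶜ).Nonempty :=
    (hp.1 A hAM).mono Finset.subset_union_left
  have hdis : Disjoint (A ∪ (support (X ∪ 𝓑))ᶜ) (support ((X ∪ 𝓑).erase A)) := by
    rw [Finset.disjoint_union_left]
    refine ⟨hp.disjoint_support_erase hAM, ?_⟩
    rw [support_erase hp hAM]
    exact disjoint_compl_left.mono_right Finset.sdiff_subset
  rw [Finset.sdiff_singleton_eq_erase, Finset.union_comm _ {_}, ← Finset.insert_eq]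
  rw [mem_kPartitions]
  refine ⟨isPartition_insert (hp.mono (Finset.erase_subset _ _)) hA0 hdis, ?_, ?_⟩
  · rw [support_insert, support_erase hp hAM]
    ext y
    simp only [Finset.mem_union, Finset.mem_compl, Finset.mem_sdiff, Finset.mem_univ, iff_true]
    tauto
  · rw [Finset.card_insert_of_notMem (notMem_of_disjoint_support hA0 hdis),
      Finset.card_erase_of_mem hAM, hc]
    have := Finset.card_pos.2 ⟨A, hAM⟩
    omega

theorem familyH_isIntersecting (hk : t + 2 ≤ k) (hX : X.card = t) (hd : Disjoint X 𝓑)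
    (hc : (X ∪ 𝓑).card = k) : IsIntersecting t (familyH n k X (X ∪ 𝓑)) := by
  have key : ∀ F ∈ meetingFamily n k X 𝓑, ∀ A ∈ X,
      t ≤ (F ∩ (((X ∪ 𝓑) \ {A}) ∪ {A ∪ (support (X ∪ 𝓑))ᶜ})).card := by
    intro F hF A hA
    obtain ⟨-, hXF, B, hB⟩ := mem_meetingFamily.1 hF
    rw [Finset.mem_inter] at hB
    have hBX : B ∉ X := fun h => Finset.disjoint_left.1 hd h hB.2
    have h1 : insert B (X.erase A) ⊆ F ∩ (((X ∪ 𝓑) \ {A}) ∪ {A ∪ (support (X ∪ 𝓑))ᶜ}) := by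
      refine Finset.subset_inter (Finset.insert_subset hB.1
        ((Finset.erase_subset _ _).trans hXF)) (Finset.subset_union_left.trans' ?_)
      refine Finset.insert_subset (Finset.mem_sdiff.2 ⟨Finset.mem_union_right _ hB.2, fun h => ?_⟩)
        fun C hC => ?_
      · exact hBX ((Finset.mem_singleton.1 h) ▸ hA)
      · rw [Finset.mem_erase] at hC
        exact Finset.mem_sdiff.2 ⟨Finset.mem_union_left _ hC.2,
          fun h => hC.1 (Finset.mem_singleton.1 h)⟩
    have h2 := Finset.card_le_card h1
    rw [Finset.card_insert_of_notMem (fun h => hBX (Finset.mem_of_mem_erase h)),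
      Finset.card_erase_of_mem hA, hX] at h2
    have := Finset.card_pos.2 ⟨A, hA⟩
    omega
  intro F hF G hG
  rw [familyH_union hd] at hF hG
  rcases Finset.mem_union.1 hF with hF | hF <;> rcases Finset.mem_union.1 hG with hG | hG
  · rw [← hX]
    exact Finset.card_le_card (Finset.subset_inter (mem_meetingFamily.1 hF).2.1
      (mem_meetingFamily.1 hG).2.1)
  · obtain ⟨A, hA, rfl⟩ := Finset.mem_image.1 hG
    exact key F hF A hA
  · obtain ⟨A, hA, rfl⟩ := Finset.mem_image.1 hF
    rw [Finset.inter_comm]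
    exact key G hG A hA
  · obtain ⟨A, hA, rfl⟩ := Finset.mem_image.1 hF
    obtain ⟨A', hA', rfl⟩ := Finset.mem_image.1 hG
    have h1 : (X ∪ 𝓑) \ {A, A'} ⊆ (((X ∪ 𝓑) \ {A}) ∪ {A ∪ (support (X ∪ 𝓑))ᶜ}) ∩
        (((X ∪ 𝓑) \ {A'}) ∪ {A' ∪ (support (X ∪ 𝓑))ᶜ}) := by
      refine Finset.subset_inter (Finset.subset_union_left.trans' ?_)
        (Finset.subset_union_left.trans' ?_) <;>
      refine Finset.sdiff_subset_sdiff subset_rfl ?_ <;> simp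
    have h2 := Finset.card_le_card h1
    have h3 := Finset.le_card_sdiff {A, A'} (X ∪ 𝓑)
    have h4 : ({A, A'} : Finset (Finset (Fin n))).card ≤ 2 := Finset.card_le_two
    omega

/-- A member that does not contain `X` is determined up to the choice of the missing block of
`X`, when `𝓑` has the largest possible size. -/
theorem eq_of_not_subset (h𝓕 : 𝓕 ⊆ kPartitions n k) (hX : X.card = t)
    (hne : 𝓑.Nonempty) (hd : Disjoint X 𝓑) (hc : 𝓑.card + t = k)
    (hcov : ∀ B ∈ 𝓑, ∀ G ∈ 𝓕, t ≤ (insert B X ∩ G).card)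
    (hpart : ∀ B ∈ 𝓑, IsPartition (insert B X))
    {G : Finset (Finset (Fin n))} (hG : G ∈ 𝓕) (hXG : ¬ X ⊆ G) :
    ∃ A ∈ X, A ∉ G ∧ G = ((X ∪ 𝓑) \ {A}) ∪ {A ∪ (support (X ∪ 𝓑))ᶜ} := by
  have hp := isPartition_union_of_cover h𝓕 hX hne hcov hpart hG hXG
  have h𝓑G : 𝓑 ⊆ G := fun B hB => (mem_of_cover_of_not_subset hX hXG (hcov B hB G hG)).1
  obtain ⟨B₀, hB₀⟩ := hne
  have hXc := (mem_of_cover_of_not_subset hX hXG (hcov B₀ hB₀ G hG)).2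
  obtain ⟨hGp, hGs, hGk⟩ := mem_kPartitions.1 (h𝓕 hG)
  obtain ⟨A, hA, hAG⟩ := Finset.not_subset.1 hXG
  have hAM : A ∈ X ∪ 𝓑 := Finset.mem_union_left _ hA
  have hMc : (X ∪ 𝓑).card = k := by rw [Finset.card_union_of_disjoint hd]; omega
  have h1 : X ∩ G = X.erase A := Finset.eq_of_subset_of_card_le (fun C hC => by
        rw [Finset.mem_inter] at hC
        exact Finset.mem_erase.2 ⟨fun h => hAG (h ▸ hC.2), hC.1⟩) (by
        rw [Finset.card_erase_of_mem hA]; omega)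
  have h2 : (X ∪ 𝓑).erase A ⊆ G := by
    intro C hC
    rw [Finset.mem_erase, Finset.mem_union] at hC
    rcases hC.2 with h | h
    · exact (Finset.mem_inter.1 (h1 ▸ Finset.mem_erase.2 ⟨hC.1, h⟩ : C ∈ X ∩ G)).2
    · exact h𝓑G h
  have h3 : (G \ (X ∪ 𝓑).erase A).card = 1 := by
    rw [Finset.card_sdiff_of_subset h2, hGk, Finset.card_erase_of_mem hAM, hMc]
    have := Finset.card_pos.2 ⟨A, hAM⟩
    omega
  obtain ⟨C, hC⟩ := Finset.card_eq_one.1 h3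
  have hCG : C ∈ G \ (X ∪ 𝓑).erase A := hC ▸ Finset.mem_singleton_self C
  rw [Finset.mem_sdiff] at hCG
  have h4 : G = insert C ((X ∪ 𝓑).erase A) := by
    rw [Finset.insert_eq, ← hC, Finset.sdiff_union_of_subset h2]
  have h5 : G.erase C = (X ∪ 𝓑).erase A := by rw [h4, Finset.erase_insert hCG.2]
  have h6 : support ((X ∪ 𝓑).erase A) = Finset.univ \ C := by
    rw [← h5, support_erase hGp hCG.1, hGs]
  have h7 : C = A ∪ (support (X ∪ 𝓑))ᶜ := by
    rw [support_erase hp hAM] at h6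
    have hAs : A ⊆ support (X ∪ 𝓑) := fun y hy => mem_support.2 ⟨A, hAM, hy⟩
    ext y
    have h8 := Finset.ext_iff.1 h6 y
    have h9 := @hAs y
    simp only [Finset.mem_sdiff, Finset.mem_univ, true_and, Finset.mem_union,
      Finset.mem_compl] at h8 h9 ⊢
    tauto
  refine ⟨A, hA, hAG, ?_⟩
  rw [← h7, Finset.sdiff_singleton_eq_erase, Finset.union_comm _ {_}, ← Finset.insert_eq, h4]

theorem eq_familyH (hmax : IsMaximalIntersecting n k t 𝓕) (hk : t + 2 ≤ k) (hX : X.card = t)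
    (hne : 𝓑.Nonempty) (hd : Disjoint X 𝓑) (hc : 𝓑.card + t = k)
    (hcov : ∀ B ∈ 𝓑, ∀ G ∈ 𝓕, t ≤ (insert B X ∩ G).card)
    (hpart : ∀ B ∈ 𝓑, IsPartition (insert B X))
    {G : Finset (Finset (Fin n))} (hG : G ∈ 𝓕) (hXG : ¬ X ⊆ G) :
    𝓕 = familyH n k X (X ∪ 𝓑) := by
  have h𝓕 := hmax.1.1
  have hp := isPartition_union_of_cover h𝓕 hX hne hcov hpart hG hXG
  have hMc : (X ∪ 𝓑).card = k := by rw [Finset.card_union_of_disjoint hd]; omega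
  refine hmax.eq_of_subset ?_ (familyH_subset_kPartitions hd hp hMc)
    (familyH_isIntersecting hk hX hd hMc)
  obtain ⟨A, hA, hAG, hGeq⟩ := eq_of_not_subset h𝓕 hX hne hd hc hcov hpart hG hXG
  intro F hF
  rw [familyH_union hd]
  by_cases hXF : X ⊆ F
  · refine Finset.mem_union_left _ (mem_meetingFamily.2 ⟨h𝓕 hF, hXF, ?_⟩)
    by_contra hne'
    have h1 : F ∩ G ⊆ X.erase A := by
      intro C hC
      rw [Finset.mem_inter] at hC
      have hCA : C ≠ A := fun h => hAG (h ▸ hC.2)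
      refine Finset.mem_erase.2 ⟨hCA, ?_⟩
      have hCG := hC.2
      rw [hGeq, Finset.mem_union, Finset.mem_sdiff, Finset.mem_singleton, Finset.mem_union] at hCG
      rcases hCG with ⟨h | h, -⟩ | h
      · exact h
      · exact absurd ⟨C, Finset.mem_inter.2 ⟨hC.1, h⟩⟩ hne'
      · -- the enlarged block meets `A`, so it cannot lie in `F` together with `A`
        obtain ⟨y, hy⟩ := hp.1 A (Finset.mem_union_left _ hA)
        have hyC : y ∈ C := by
          rw [Finset.mem_singleton.1 h]; exact Finset.mem_union_left _ hy
        exact absurd ((mem_kPartitions.1 (h𝓕 hF)).1.eq_of_mem hC.1 (hXF hA) hyC hy) hCA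
    have h2 := Finset.card_le_card h1
    rw [Finset.card_erase_of_mem hA, hX] at h2
    have h3 := hmax.1.2 F hF G hG
    have := Finset.card_pos.2 ⟨A, hA⟩
    omega
  · obtain ⟨A', hA', -, hF'⟩ := eq_of_not_subset h𝓕 hX hne hd hc hcov hpart hF hXF
    exact Finset.mem_union_right _ (Finset.mem_image.2 ⟨A', hA', hF'.symm⟩)

end BlockPartition

/-! ### Replacing blocks by singletons and relabelling the ground set -/

namespace BlockPartition

variable {n k t : ℕ} {X 𝓑 : Finset (Finset (Fin n))}

/-- The `k`-partitions that contain `X` and the block `B` but no block of `𝓑`. -/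
def avoidingFamily (n k : ℕ) (X : Finset (Finset (Fin n))) (B : Finset (Fin n))
    (𝓑 : Finset (Finset (Fin n))) : Finset (Finset (Finset (Fin n))) :=
  (star (kPartitions n k) (insert B X)).filter fun F => Disjoint F 𝓑

theorem mem_avoidingFamily {B : Finset (Fin n)} {F : Finset (Finset (Fin n))} :
    F ∈ avoidingFamily n k X B 𝓑 ↔ F ∈ kPartitions n k ∧ insert B X ⊆ F ∧ Disjoint F 𝓑 := by
  rw [avoidingFamily, Finset.mem_filter, mem_star, and_assoc]

theorem card_meetingFamily_insert (B : Finset (Fin n)) :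
    (meetingFamily n k X (insert B 𝓑)).card
      = (meetingFamily n k X 𝓑).card + (avoidingFamily n k X B 𝓑).card := by
  rw [← Finset.card_union_of_disjoint]
  · congr 1
    ext F
    rw [Finset.mem_union, mem_meetingFamily, mem_meetingFamily, mem_avoidingFamily,
      Finset.insert_subset_iff, Finset.disjoint_iff_inter_eq_empty]
    by_cases hB : B ∈ F
    · have h1 : (F ∩ insert B 𝓑).Nonempty :=
        ⟨B, Finset.mem_inter.2 ⟨hB, Finset.mem_insert_self _ _⟩⟩
      have h2 := (F ∩ 𝓑).eq_empty_or_nonempty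
      tauto
    · rw [Finset.inter_insert_of_notMem hB]
      tauto
  · rw [Finset.disjoint_left]
    intro F h1 h2
    exact Finset.not_disjoint_iff_nonempty_inter.2 (mem_meetingFamily.1 h1).2.2
      (mem_avoidingFamily.1 h2).2.2

theorem card_avoidingFamily_le (B : Finset (Fin n)) :
    (avoidingFamily n k X B 𝓑).card ≤ (star (kPartitions n k) (insert B X)).card :=
  Finset.card_le_card (Finset.filter_subset _ _)

/-- Shrinking the block `B` to one of its points `b` can only increase the number of partitions:
the points of `B` other than `b` are moved to another block outside `X`, and this is injective
because `B` is known. -/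
theorem card_avoidingFamily_le_singleton {B : Finset (Fin n)} {b : Fin n} (hb : b ∈ B)
    (hX : X.card + 2 ≤ k) (hBX : B ∉ X) (hB : ∀ D ∈ 𝓑, Disjoint B D) :
    (avoidingFamily n k X B 𝓑).card ≤ (avoidingFamily n k X {b} 𝓑).card := by
  have hex : ∀ F ∈ avoidingFamily n k X B 𝓑, ∃ C ∈ F, C ∉ insert B X := by
    intro F hF
    obtain ⟨hF, -, -⟩ := mem_avoidingFamily.1 hF
    by_contra! h
    have h1 := Finset.card_le_card (show F ⊆ insert B X from h)
    rw [(mem_kPartitions.1 hF).2.2, Finset.card_insert_of_notMem hBX] at h1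
    omega
  choose! g hg using hex
  have hdata : ∀ F ∈ avoidingFamily n k X B 𝓑, IsPartition F ∧ support F = Finset.univ ∧
      F.card = k ∧ B ∈ F ∧ X ⊆ F ∧ Disjoint F 𝓑 ∧ g F ∈ F ∧ g F ≠ B ∧ g F ∉ X ∧
      Disjoint (g F) B := by
    intro F hF
    obtain ⟨h1, h2⟩ := hg F hF
    obtain ⟨hF, hXF, hd⟩ := mem_avoidingFamily.1 hF
    obtain ⟨hp, hs, hc⟩ := mem_kPartitions.1 hF
    rw [Finset.mem_insert, not_or] at h2
    have hBF := hXF (Finset.mem_insert_self _ _)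
    exact ⟨hp, hs, hc, hBF, (Finset.subset_insert _ _).trans hXF, hd, h1, h2.1, h2.2,
      hp.2 _ h1 _ hBF h2.1⟩
  refine Finset.card_le_card_of_injOn
    (fun F => insert {b} (insert (g F ∪ B.erase b) ((F.erase B).erase (g F)))) ?_ ?_
  · intro F hF
    obtain ⟨hp, hs, hc, hBF, hXF, hd, hg1, hg2, hg3, hg4⟩ := hdata F hF
    have hgB : g F ∈ F.erase B := Finset.mem_erase.2 ⟨hg2, hg1⟩
    have hpB : IsPartition (F.erase B) := hp.mono (Finset.erase_subset _ _)
    have hs1 : support ((F.erase B).erase (g F)) = (Finset.univ \ B) \ g F := by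
      rw [support_erase hpB hgB, support_erase hp hBF, hs]
    have hne1 : (g F ∪ B.erase b).Nonempty := (hp.1 _ hg1).mono Finset.subset_union_left
    have hd1 : Disjoint (g F ∪ B.erase b) (support ((F.erase B).erase (g F))) := by
      rw [hs1, Finset.disjoint_left]
      intro y hy hy'
      simp only [Finset.mem_union, Finset.mem_erase, Finset.mem_sdiff, Finset.mem_univ,
        true_and] at hy hy'
      tauto
    have hd2 : Disjoint {b}
        (support (insert (g F ∪ B.erase b) ((F.erase B).erase (g F)))) := by
      rw [support_insert, hs1, Finset.disjoint_singleton_left]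
      have : b ∉ g F := fun h => Finset.disjoint_left.1 hg4 h hb
      simp [this, hb]
    rw [Finset.mem_coe, mem_avoidingFamily, mem_kPartitions]
    refine ⟨⟨isPartition_insert (isPartition_insert (hpB.mono (Finset.erase_subset _ _)) hne1 hd1)
      (Finset.singleton_nonempty b) hd2, ?_, ?_⟩, ?_, ?_⟩
    · rw [support_insert, support_insert, hs1]
      ext y
      simp only [Finset.mem_union, Finset.mem_singleton, Finset.mem_erase, Finset.mem_sdiff,
        Finset.mem_univ, true_and, iff_true]
      tauto
    · rw [Finset.card_insert_of_notMem
          (notMem_of_disjoint_support (Finset.singleton_nonempty b) hd2),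
        Finset.card_insert_of_notMem (notMem_of_disjoint_support hne1 hd1),
        Finset.card_erase_of_mem hgB, Finset.card_erase_of_mem hBF, hc]
      omega
    · refine Finset.insert_subset_insert _ fun C hC => Finset.mem_insert_of_mem ?_
      exact Finset.mem_erase.2 ⟨fun h => hg3 (h ▸ hC),
        Finset.mem_erase.2 ⟨fun h => hBX (h ▸ hC), hXF hC⟩⟩
    · rw [Finset.disjoint_left]
      intro D hD hDB
      rcases Finset.mem_insert.1 hD with h | h
      · exact Finset.disjoint_left.1 (hB D hDB) hb (h ▸ Finset.mem_singleton_self b)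
      · rcases Finset.mem_insert.1 h with h | h
        · by_cases he : B.erase b = ∅
          · rw [he, Finset.union_empty] at h
            exact Finset.disjoint_left.1 hd (h ▸ hg1) hDB
          · obtain ⟨y, hy⟩ := Finset.nonempty_iff_ne_empty.2 he
            exact Finset.disjoint_left.1 (hB D hDB) (Finset.mem_of_mem_erase hy)
              (h ▸ Finset.mem_union_right _ hy)
        · exact Finset.disjoint_left.1 hd (Finset.mem_of_mem_erase (Finset.mem_of_mem_erase h)) hDB
  · refine Set.LeftInvOn.injOn
      (f₁' := fun G => insert B ((G.erase {b}).image fun D => D \ B.erase b)) ?_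
    intro F hF
    obtain ⟨hp, hs, hc, hBF, hXF, hd, hg1, hg2, hg3, hg4⟩ := hdata F hF
    have hgB : g F ∈ F.erase B := Finset.mem_erase.2 ⟨hg2, hg1⟩
    have hbg : b ∉ g F := fun h => Finset.disjoint_left.1 hg4 h hb
    have h1 : ({b} : Finset (Fin n)) ∉ insert (g F ∪ B.erase b) ((F.erase B).erase (g F)) := by
      intro h
      rcases Finset.mem_insert.1 h with h | h
      · have : b ∈ g F ∪ B.erase b := h ▸ Finset.mem_singleton_self b
        simp [hbg] at this
      · rw [Finset.mem_erase, Finset.mem_erase] at h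
        exact h.2.1 (hp.eq_of_mem h.2.2 hBF (Finset.mem_singleton_self b) hb)
    have h2 : (g F ∪ B.erase b) \ B.erase b = g F := by
      rw [Finset.union_sdiff_right]
      exact Finset.sdiff_eq_self_of_disjoint (hg4.mono_right (Finset.erase_subset _ _))
    have h3 : ((F.erase B).erase (g F)).image (fun D => D \ B.erase b)
        = (F.erase B).erase (g F) := by
      conv_rhs => rw [← Finset.image_id (s := (F.erase B).erase (g F))]
      refine Finset.image_congr fun D hD => ?_
      rw [Finset.mem_coe, Finset.mem_erase, Finset.mem_erase] at hD
      exact Finset.sdiff_eq_self_of_disjoint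
        ((hp.2 _ hD.2.2 _ hBF hD.2.1).mono_right (Finset.erase_subset _ _))
    dsimp only
    rw [Finset.erase_insert h1, Finset.image_insert, h2, h3, Finset.insert_erase hgB,
      Finset.insert_erase hBF]

theorem mem_singletons {C : Finset (Fin n)} {B : Finset (Fin n)} :
    B ∈ singletons C ↔ ∃ x ∈ C, {x} = B := by
  simp [singletons]

theorem card_singletons (C : Finset (Fin n)) : (singletons C).card = C.card :=
  Finset.card_image_of_injective _ Finset.singleton_injective

theorem singletons_insert (b : Fin n) (C : Finset (Fin n)) :
    singletons (insert b C) = insert {b} (singletons C) := by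
  simp [singletons, Finset.image_insert]

theorem singletons_union (A C : Finset (Fin n)) :
    singletons (A ∪ C) = singletons A ∪ singletons C := by
  simp [singletons, Finset.image_union]

theorem disjoint_singletons {A C : Finset (Fin n)} (h : Disjoint A C) :
    Disjoint (singletons A) (singletons C) := by
  rw [Finset.disjoint_left]
  intro B hB hB'
  obtain ⟨x, hx, rfl⟩ := mem_singletons.1 hB
  obtain ⟨y, hy, hxy⟩ := mem_singletons.1 hB'
  rw [Finset.singleton_inj] at hxy
  exact Finset.disjoint_left.1 h hx (hxy ▸ hy)

theorem support_singletons (C : Finset (Fin n)) : support (singletons C) = C := by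
  ext x
  simp [support, singletons]

theorem isPartition_singletons (C : Finset (Fin n)) : IsPartition (singletons C) := by
  refine ⟨fun A hA => ?_, fun A hA B hB hAB => ?_⟩
  · obtain ⟨x, -, rfl⟩ := mem_singletons.1 hA
    exact Finset.singleton_nonempty x
  · obtain ⟨x, -, rfl⟩ := mem_singletons.1 hA
    obtain ⟨y, -, rfl⟩ := mem_singletons.1 hB
    rw [Finset.disjoint_singleton]
    exact fun h => hAB (by rw [h])

/-- The induction replaces the blocks of `𝓑` one at a time, so the blocks treated already have to be
carried along as `ℰ`. -/
theorem exists_card_meetingFamily_le_aux (hX : X.card + 2 ≤ k) (𝓑 : Finset (Finset (Fin n))) :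
    ∀ ℰ : Finset (Finset (Fin n)), IsPartition (𝓑 ∪ ℰ) → Disjoint 𝓑 ℰ → Disjoint X 𝓑 →
      ∃ C ⊆ support 𝓑, C.card = 𝓑.card ∧
        (meetingFamily n k X (𝓑 ∪ ℰ)).card ≤ (meetingFamily n k X (singletons C ∪ ℰ)).card := by
  induction 𝓑 using Finset.induction_on with
  | empty =>
    intro ℰ _ _ _
    exact ⟨∅, by simp, rfl, by simp [singletons]⟩
  | insert B 𝓑 hB ih =>
    intro ℰ hp hd hdX
    rw [Finset.disjoint_insert_left] at hd
    rw [Finset.disjoint_insert_right] at hdX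
    rw [Finset.insert_union] at hp ⊢
    have hBmem : B ∈ insert B (𝓑 ∪ ℰ) := Finset.mem_insert_self _ _
    have hBn : B ∉ 𝓑 ∪ ℰ := fun h => (Finset.mem_union.1 h).elim hB hd.1
    obtain ⟨b, hb⟩ := hp.1 B hBmem
    have hp' : IsPartition (𝓑 ∪ ℰ) := hp.mono (Finset.subset_insert _ _)
    have hds : Disjoint B (support (𝓑 ∪ ℰ)) := by
      have := hp.disjoint_support_erase hBmem
      rwa [Finset.erase_insert hBn] at this
    have hds' : Disjoint {b} (support (𝓑 ∪ ℰ)) :=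
      hds.mono_left (Finset.singleton_subset_iff.2 hb)
    have hbn := notMem_of_disjoint_support (Finset.singleton_nonempty b) hds'
    have h1 : (meetingFamily n k X (insert B (𝓑 ∪ ℰ))).card
        ≤ (meetingFamily n k X (insert {b} (𝓑 ∪ ℰ))).card := by
      rw [card_meetingFamily_insert, card_meetingFamily_insert]
      refine Nat.add_le_add_left (card_avoidingFamily_le_singleton hb hX hdX.1 fun D hD => ?_) _
      exact hp.2 _ hBmem _ (Finset.mem_insert_of_mem hD) fun h => hBn (h ▸ hD)
    obtain ⟨C, hCs, hCc, hC⟩ := ih (insert {b} ℰ)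
      (by rw [Finset.union_insert]
          exact isPartition_insert hp' (Finset.singleton_nonempty b) hds')
      (by rw [Finset.disjoint_insert_right]
          exact ⟨fun h => hbn (Finset.mem_union_left _ h), hd.2⟩) hdX.2
    have hbC : b ∉ C := fun h => Finset.disjoint_left.1 hds hb
      (by rw [support_union]; exact Finset.mem_union_left _ (hCs h))
    refine ⟨insert b C, ?_, ?_, ?_⟩
    · rw [support_insert]
      exact Finset.insert_subset (Finset.mem_union_left _ hb)
        (hCs.trans Finset.subset_union_right)
    · rw [Finset.card_insert_of_notMem hbC, Finset.card_insert_of_notMem hB, hCc]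
    · rw [Finset.union_insert, Finset.union_insert] at hC
      rw [singletons_insert, Finset.insert_union]
      exact h1.trans hC

/-- Replacing the blocks of `𝓑` by singletons can only enlarge the meeting family. -/
theorem exists_card_meetingFamily_le (hX : X.card + 2 ≤ k) (hp : IsPartition 𝓑)
    (hd : Disjoint X 𝓑) :
    ∃ C ⊆ support 𝓑, C.card = 𝓑.card ∧
      (meetingFamily n k X 𝓑).card ≤ (meetingFamily n k X (singletons C)).card := by
  simpa using exists_card_meetingFamily_le_aux hX 𝓑 ∅ (by simpa using hp) (by simp) hd

/-- Relabelling the ground set by `σ`. -/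
def relabel (σ : Equiv.Perm (Fin n)) (P : Finset (Finset (Fin n))) : Finset (Finset (Fin n)) :=
  P.image fun B => B.image σ

section Relabel

variable (σ : Equiv.Perm (Fin n))

theorem blockImage_injective : Function.Injective fun B : Finset (Fin n) => B.image σ :=
  Finset.image_injective σ.injective

theorem relabel_injective : Function.Injective (relabel σ) :=
  Finset.image_injective (blockImage_injective σ)

theorem relabel_relabel_symm (P : Finset (Finset (Fin n))) : relabel σ (relabel σ.symm P) = P := by
  simp [relabel, Finset.image_image, Function.comp_def]

theorem support_relabel (P : Finset (Finset (Fin n))) :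
    support (relabel σ P) = (support P).image σ := by
  ext x
  simp only [mem_support, relabel, Finset.mem_image]
  constructor
  · rintro ⟨_, ⟨A, hA, rfl⟩, hx⟩
    obtain ⟨y, hy, rfl⟩ := Finset.mem_image.1 hx
    exact ⟨y, ⟨A, hA, hy⟩, rfl⟩
  · rintro ⟨y, ⟨A, hA, hy⟩, rfl⟩
    exact ⟨_, ⟨A, hA, rfl⟩, Finset.mem_image_of_mem _ hy⟩

theorem relabel_mem_kPartitions {P : Finset (Finset (Fin n))} (hP : P ∈ kPartitions n k) :
    relabel σ P ∈ kPartitions n k := by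
  obtain ⟨hp, hs, hc⟩ := mem_kPartitions.1 hP
  rw [mem_kPartitions]
  refine ⟨⟨fun A hA => ?_, fun A hA B hB hAB => ?_⟩, ?_, ?_⟩
  · obtain ⟨A', hA', rfl⟩ := Finset.mem_image.1 hA
    exact (hp.1 A' hA').image _
  · obtain ⟨A', hA', rfl⟩ := Finset.mem_image.1 hA
    obtain ⟨B', hB', rfl⟩ := Finset.mem_image.1 hB
    exact (Finset.disjoint_image σ.injective).2 (hp.2 A' hA' B' hB' fun h => hAB (by rw [h]))
  · rw [support_relabel, hs]
    exact Finset.image_univ_of_surjective σ.surjective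
  · rw [relabel, Finset.card_image_of_injective _ (blockImage_injective σ), hc]

theorem relabel_subset {P Q : Finset (Finset (Fin n))} : relabel σ P ⊆ relabel σ Q ↔ P ⊆ Q :=
  Finset.image_subset_image_iff (blockImage_injective σ)

theorem relabel_inter (P Q : Finset (Finset (Fin n))) :
    relabel σ (P ∩ Q) = relabel σ P ∩ relabel σ Q :=
  Finset.image_inter _ _ (blockImage_injective σ)

theorem relabel_union (P Q : Finset (Finset (Fin n))) :
    relabel σ (P ∪ Q) = relabel σ P ∪ relabel σ Q :=
  Finset.image_union _ _

theorem relabel_sdiff (P Q : Finset (Finset (Fin n))) :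
    relabel σ (P \ Q) = relabel σ P \ relabel σ Q :=
  Finset.image_sdiff _ _ (blockImage_injective σ)

theorem relabel_singleton (B : Finset (Fin n)) : relabel σ {B} = {B.image σ} :=
  Finset.image_singleton _ _

theorem relabel_singletons (C : Finset (Fin n)) :
    relabel σ (singletons C) = singletons (C.image σ) := by
  simp [relabel, singletons, Finset.image_image, Function.comp_def]

theorem image_relabel_meetingFamily (X 𝓑 : Finset (Finset (Fin n))) :
    (meetingFamily n k X 𝓑).image (relabel σ)
      = meetingFamily n k (relabel σ X) (relabel σ 𝓑) := by
  ext G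
  rw [Finset.mem_image]
  constructor
  · rintro ⟨F, hF, rfl⟩
    obtain ⟨h1, h2, h3⟩ := mem_meetingFamily.1 hF
    rw [mem_meetingFamily, relabel_subset, ← relabel_inter]
    exact ⟨relabel_mem_kPartitions σ h1, h2, h3.image _⟩
  · intro hG
    obtain ⟨h1, h2, h3⟩ := mem_meetingFamily.1 hG
    refine ⟨relabel σ.symm G, ?_, relabel_relabel_symm σ G⟩
    rw [← relabel_relabel_symm σ G, relabel_subset] at h2
    rw [← relabel_relabel_symm σ G, ← relabel_inter] at h3
    exact mem_meetingFamily.2 ⟨relabel_mem_kPartitions σ.symm h1, h2, Finset.image_nonempty.1 h3⟩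

theorem image_relabel_familyH (X M : Finset (Finset (Fin n))) :
    (familyH n k X M).image (relabel σ) = familyH n k (relabel σ X) (relabel σ M) := by
  have h1 := image_relabel_meetingFamily (k := k) σ X (M \ X)
  rw [relabel_sdiff] at h1
  change (meetingFamily n k X (M \ X) ∪ _).image _
    = meetingFamily n k (relabel σ X) (relabel σ M \ relabel σ X) ∪ _
  rw [Finset.image_union, h1, Finset.image_image]
  congr 1
  rw [show relabel σ X = X.image (fun B => B.image σ) from rfl, Finset.image_image]
  refine Finset.image_congr fun B _ => ?_
  simp only [Function.comp_apply, relabel_union, relabel_sdiff, relabel_singleton,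
    support_relabel, Finset.image_union]
  rw [Finset.compl_eq_univ_sdiff, Finset.compl_eq_univ_sdiff,
    Finset.image_sdiff _ _ σ.injective, Finset.image_univ_of_surjective σ.surjective]

end Relabel

/-- A permutation sorting the values of `f` maps every sublevel set of `f` to an initial
segment. -/
theorem exists_perm_image_eq_firstElems (f : Fin n → ℕ) :
    ∃ σ : Equiv.Perm (Fin n), ∀ r, (Finset.univ.filter fun x => f x ≤ r).image σ
      = firstElems n (Finset.univ.filter fun x => f x ≤ r).card := by
  refine ⟨(Tuple.sort f).symm, fun r => ?_⟩
  have h1 : (Finset.univ.filter fun x => (f ∘ Tuple.sort f) x ≤ r)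
      = (Finset.univ.filter fun x => f x ≤ r).image (Tuple.sort f).symm := by
    ext x
    simp only [Finset.mem_filter, Finset.mem_univ, true_and, Function.comp_apply,
      Finset.mem_image]
    constructor
    · exact fun h => ⟨_, h, Equiv.symm_apply_apply _ _⟩
    · rintro ⟨y, hy, rfl⟩
      simpa using hy
  have h2 : (Finset.univ.filter fun x => (f ∘ Tuple.sort f) x ≤ r).card
      = (Finset.univ.filter fun x => f x ≤ r).card := by
    rw [h1, Finset.card_image_of_injective _ (Equiv.injective _)]
  rw [← h1, ← h2]
  ext x
  rw [firstElems, Finset.mem_filter, Finset.mem_filter]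
  simp only [Finset.mem_univ, true_and]
  exact (Tuple.lt_card_le_iff_apply_le_of_monotone (j := x) (Tuple.monotone_sort f)).symm

/-- A chain of three sets is carried to initial segments by one permutation. -/
theorem exists_perm_chain {A C E : Finset (Fin n)} (hAC : A ⊆ C) (hCE : C ⊆ E) :
    ∃ σ : Equiv.Perm (Fin n), A.image σ = firstElems n A.card ∧
      C.image σ = firstElems n C.card ∧ E.image σ = firstElems n E.card := by
  obtain ⟨σ, hσ⟩ := exists_perm_image_eq_firstElems
    (fun x => if x ∈ A then 0 else if x ∈ C then 1 else if x ∈ E then 2 else 3)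
  have h0 : (Finset.univ.filter fun x =>
      (if x ∈ A then 0 else if x ∈ C then 1 else if x ∈ E then 2 else 3) ≤ 0) = A := by
    ext x
    simp only [Finset.mem_filter, Finset.mem_univ, true_and]
    split_ifs <;> simp_all
  have h1 : (Finset.univ.filter fun x =>
      (if x ∈ A then 0 else if x ∈ C then 1 else if x ∈ E then 2 else 3) ≤ 1) = C := by
    ext x
    have := @hAC x
    simp only [Finset.mem_filter, Finset.mem_univ, true_and]
    split_ifs <;> simp_all
  have h2 : (Finset.univ.filter fun x =>
      (if x ∈ A then 0 else if x ∈ C then 1 else if x ∈ E then 2 else 3) ≤ 2) = E := by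
    ext x
    have := @hAC x
    have := @hCE x
    simp only [Finset.mem_filter, Finset.mem_univ, true_and]
    split_ifs <;> simp_all
  have e0 := hσ 0
  have e1 := hσ 1
  have e2 := hσ 2
  rw [h0] at e0
  rw [h1] at e1
  rw [h2] at e2
  exact ⟨σ, e0, e1, e2⟩

/-- The number of `k`-partitions that contain the first `t` singletons and one of the next `c`
singletons. -/
def singletonCount (n k t c : ℕ) : ℕ :=
  (meetingFamily n k (singletons (firstElems n t))
    (singletons (firstElems n (t + c) \ firstElems n t))).card

theorem card_meetingFamily_singletons {A C : Finset (Fin n)} (h : Disjoint A C) :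
    (meetingFamily n k (singletons A) (singletons C)).card
      = singletonCount n k A.card C.card := by
  obtain ⟨σ, h1, h2, -⟩ := exists_perm_chain (A := A) (C := A ∪ C) (E := A ∪ C)
    Finset.subset_union_left subset_rfl
  have h3 : C.image σ = firstElems n (A.card + C.card) \ firstElems n A.card := by
    rw [← h1, ← Finset.card_union_of_disjoint h, ← h2, ← Finset.image_sdiff _ _ σ.injective,
      Finset.union_sdiff_cancel_left h]
  rw [singletonCount, ← h3, ← h1, ← relabel_singletons, ← relabel_singletons,
    ← image_relabel_meetingFamily, Finset.card_image_of_injective _ (relabel_injective σ)]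

theorem card_firstElems {m : ℕ} (h : m ≤ n) : (firstElems n m).card = m := by
  rw [firstElems, Fin.card_filter_val_lt, min_eq_right h]

theorem firstElems_mono {a b : ℕ} (h : a ≤ b) : firstElems n a ⊆ firstElems n b := by
  intro x hx
  simp only [firstElems, Finset.mem_filter, Finset.mem_univ, true_and] at hx ⊢
  omega

/-- The contribution of one more singleton is `S(n - t - 1, k - t - 1)` up to overlaps with the
previous ones. -/
theorem le_singletonCount_succ {c : ℕ} (hk : t + 3 ≤ k) (hc : t + c + 1 ≤ n) :
    singletonCount n k t c + Nat.stirlingSecond (n - (t + 1)) (k - (t + 1))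
      ≤ singletonCount n k t (c + 1)
        + c * Nat.stirlingSecond (n - (t + 2)) (k - (t + 2)) := by
  set A := firstElems n t with hA
  set C := firstElems n (t + c) \ A with hC
  have hAC : Disjoint A C := Finset.disjoint_sdiff
  have hAc : A.card = t := card_firstElems (by omega)
  have hCc : C.card = c := by
    rw [hC, Finset.card_sdiff_of_subset (firstElems_mono (by omega)), card_firstElems (by omega),
      hAc]
    omega
  let b : Fin n := ⟨t + c, by omega⟩
  have hb : b ∉ A ∪ C := by simp [hA, hC, b, firstElems]
  rw [Finset.mem_union, not_or] at hb
  have hAbC : Disjoint A (insert b C) := Finset.disjoint_insert_right.2 ⟨hb.1, hAC⟩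
  have e1 := card_meetingFamily_singletons (k := k) hAC
  have e2 := card_meetingFamily_singletons (k := k) hAbC
  rw [Finset.card_insert_of_notMem hb.2, singletons_insert, card_meetingFamily_insert, e1, hAc,
    hCc] at e2
  rw [← e2, add_assoc]
  apply Nat.add_le_add_left
  have h1 : (star (kPartitions n k) (insert {b} (singletons A))).card
      = Nat.stirlingSecond (n - (t + 1)) (k - (t + 1)) := by
    rw [← singletons_insert, card_star_kPartitions (isPartition_singletons _), support_singletons,
      card_singletons, Finset.card_insert_of_notMem hb.1, hAc]
    rw [card_singletons, Finset.card_insert_of_notMem hb.1, hAc]; omega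
  rw [← h1, ← hCc, ← card_singletons C]
  have h2 : star (kPartitions n k) (insert {b} (singletons A)) ⊆
      avoidingFamily n k (singletons A) {b} (singletons C) ∪
        (singletons C).biUnion fun D =>
          star (kPartitions n k) (insert D (insert {b} (singletons A))) := by
    intro F hF
    by_cases hd : Disjoint F (singletons C)
    · exact Finset.mem_union_left _ (Finset.mem_filter.2 ⟨hF, hd⟩)
    · obtain ⟨D, hD, hD'⟩ := Finset.not_disjoint_iff.1 hd
      exact Finset.mem_union_right _ (Finset.mem_biUnion.2 ⟨D, hD', mem_star.2
        ⟨(mem_star.1 hF).1, Finset.insert_subset hD (mem_star.1 hF).2⟩⟩)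
  refine (Finset.card_le_card h2).trans ((Finset.card_union_le _ _).trans
    (Nat.add_le_add_left (Finset.card_biUnion_le_card_mul _ _ _ fun D hD =>
      card_star_le subset_rfl ?_ (by omega)) _))
  obtain ⟨x, hx, rfl⟩ := mem_singletons.1 hD
  rw [← singletons_insert, ← singletons_insert, card_singletons, Finset.card_insert_of_notMem,
    Finset.card_insert_of_notMem hb.1, hAc]
  rw [Finset.mem_insert, not_or]
  exact ⟨fun h => hb.2 (h ▸ hx), fun h => Finset.disjoint_left.1 hAC h hx⟩

theorem le_singletonCount {c : ℕ} (hk : t + 3 ≤ k) (hc : t + c ≤ n) :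
    c * Nat.stirlingSecond (n - (t + 1)) (k - (t + 1))
      ≤ singletonCount n k t c
        + c.choose 2 * Nat.stirlingSecond (n - (t + 2)) (k - (t + 2)) := by
  induction c with
  | zero => simp
  | succ c ih =>
    have h1 := ih (by omega)
    have h2 := le_singletonCount_succ hk hc
    rw [Nat.choose_succ_succ' c 1, Nat.choose_one_right, Nat.add_mul, Nat.succ_mul]
    linarith

theorem singletons_firstElems {a b : ℕ} (h : a ≤ b) :
    singletons (firstElems n b) = singletons (firstElems n a)
      ∪ singletons (firstElems n b \ firstElems n a) := by
  rw [← singletons_union, Finset.union_sdiff_of_subset (firstElems_mono h)]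

/-- The `t` partitions of `familyH₀` with an enlarged block are distinct and do not contain all of
the first `t` singletons. -/
theorem le_card_familyH₀ (htk : t < k) (hkn : k < n) :
    singletonCount n k t (k - t) + t ≤ (familyH₀ n k t).card := by
  have hA : (firstElems n t).card = t := card_firstElems (by omega)
  have hd : Disjoint (firstElems n t) (firstElems n k \ firstElems n t) := Finset.disjoint_sdiff
  rw [familyH₀, singletons_firstElems htk.le, familyH_union (disjoint_singletons hd),
    ← singletons_union, Finset.union_sdiff_of_subset (firstElems_mono htk.le), support_singletons]
  -- the last point is uncovered, so an enlarged block is never a singleton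
  let z : Fin n := ⟨k, hkn⟩
  have hz : z ∈ (firstElems n k)ᶜ := by simp [firstElems, z]
  have hnot : ∀ x y : Fin n, x ∈ firstElems n k →
      ({x} : Finset (Fin n)) ≠ {y} ∪ (firstElems n k)ᶜ := by
    intro x y hx h
    have h1 : z ∈ ({x} : Finset (Fin n)) := h ▸ Finset.mem_union_right _ hz
    rw [Finset.mem_singleton] at h1
    exact (Finset.mem_compl.1 hz) (h1 ▸ hx)
  have hsub := firstElems_mono (n := n) htk.le
  rw [Finset.card_union_of_disjoint]
  · refine Nat.add_le_add (le_of_eq ?_) (le_of_eq ?_)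
    · rw [singletonCount, Nat.add_sub_cancel' htk.le]
    · rw [Finset.card_image_of_injOn, card_singletons, hA]
      intro B hB B' hB' h
      obtain ⟨x, hx, rfl⟩ := mem_singletons.1 hB
      obtain ⟨y, hy, rfl⟩ := mem_singletons.1 hB'
      by_contra hne
      have h1 : ({x} : Finset (Fin n)) ∈
          (singletons (firstElems n k) \ {{y}}) ∪ {{y} ∪ (firstElems n k)ᶜ} :=
        Finset.mem_union_left _ (Finset.mem_sdiff.2
          ⟨mem_singletons.2 ⟨x, hsub hx, rfl⟩, fun h => hne (Finset.mem_singleton.1 h)⟩)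
      dsimp only at h
      rw [← h, Finset.mem_union, Finset.mem_sdiff, Finset.mem_singleton, Finset.mem_singleton] at h1
      rcases h1 with h1 | h1
      · exact h1.2 rfl
      · exact hnot x x (hsub hx) h1
  · rw [Finset.disjoint_left]
    intro F hF hF'
    obtain ⟨B, hB, rfl⟩ := Finset.mem_image.1 hF'
    obtain ⟨x, hx, rfl⟩ := mem_singletons.1 hB
    have h1 := (mem_meetingFamily.1 hF).2.1 hB
    rw [Finset.mem_union, Finset.mem_sdiff, Finset.mem_singleton, Finset.mem_singleton] at h1
    rcases h1 with h1 | h1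
    · exact h1.2 rfl
    · exact hnot x x (hsub hx) h1

end BlockPartition

/-! ### The structure of maximal non-trivial families -/

namespace BlockPartition

variable {n k t j : ℕ} {𝓕 : Finset (Finset (Finset (Fin n)))} {X 𝓑 : Finset (Finset (Fin n))}

/-- The trichotomy for a maximal non-trivial `t`-intersecting family: it is small, or it is
`familyA` for some `Z`, or, up to few members, it consists of the partitions that contain a
`t`-set `X` and meet a set `𝓑` of at most `k - t` blocks, and it is `familyH` when `|𝓑| = k - t`. -/
theorem structure_of_maximal (hj : 2 ≤ j)
    (hN : 4 ^ (t + 1) * (((t + 1) * (j + 2)) ^ 2) ^ (j + 2) ≤ 2 ^ n)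
    (hmax : IsMaximalIntersecting n (t + 1 + j) t 𝓕) (hnt : ¬ IsTrivial t 𝓕) :
    𝓕.card ≤ 2 * Nat.stirlingSecond (n - (t + 1)) j + (t + 1) * ((j + 2) *
        (max (j + 2) (t + 1) * Nat.stirlingSecond (n - (t + 2)) (j - 1))) ∨
    (∃ Z : Finset (Finset (Fin n)), IsPartition Z ∧ Z.card = t + 2 ∧
      𝓕 = familyA n (t + 1 + j) t Z) ∨
    ∃ X 𝓑 : Finset (Finset (Fin n)), X.card = t ∧ Disjoint X 𝓑 ∧ IsPartition (X ∪ 𝓑) ∧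
      𝓑.card ≤ j + 1 ∧
      𝓕.card ≤ (meetingFamily n (t + 1 + j) X 𝓑).card + ((j + 2 - 𝓑.card) *
        (max (j + 2) (t + 1) * Nat.stirlingSecond (n - (t + 2)) (j - 1))
        + t * Nat.stirlingSecond (n - (t + 2)) (j - 1)) ∧
      (𝓑.card = j + 1 → 𝓕 = familyH n (t + 1 + j) X (X ∪ 𝓑)) := by
  have h𝓕 := hmax.1.1
  have hint := hmax.1.2
  have e1 : t + 1 + j - (t + 1) = j := by omega
  have e2 : t + 1 + j - (t + 2) = j - 1 := by omega
  have e3 : t + 1 + j - t + 1 = j + 2 := by omega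
  rcases 𝓕.eq_empty_or_nonempty with rfl | ⟨F₀, hF₀⟩
  · exact Or.inl (by simp)
  set c := max (j + 2) (t + 1) * Nat.stirlingSecond (n - (t + 2)) (j - 1) with hcdef
  have hntX : ∀ U : Finset (Finset (Fin n)), U.card = t → ∃ G ∈ 𝓕, ¬ U ⊆ G := by
    intro U hU
    by_contra! h
    exact hnt ⟨U, (mem_kPartitions.1 (h𝓕 hF₀)).1.mono (h _ hF₀), hU, h⟩
  have hnc : ∀ U : Finset (Finset (Fin n)), U.card ≤ t → ∃ G ∈ 𝓕, (U ∩ G).card < t := by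
    intro U hU
    rcases Nat.lt_or_eq_of_le hU with h | h
    · exact ⟨F₀, hF₀, (Finset.card_le_card Finset.inter_subset_left).trans_lt h⟩
    · obtain ⟨G, hG, hUG⟩ := hntX U h
      refine ⟨G, hG, ?_⟩
      rw [← h]
      exact Finset.card_lt_card ⟨Finset.inter_subset_left,
        fun h => hUG (h.trans Finset.inter_subset_right)⟩
  by_cases hcov : ∃ T : Finset (Finset (Fin n)), T.card ≤ t + 1 ∧ ∀ G ∈ 𝓕, t ≤ (T ∩ G).card
  swap
  · push Not at hcov
    have := card_le_of_no_small_cover hj hN h𝓕 hint hcov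
    exact Or.inl (by omega)
  obtain ⟨T, hTc, hT⟩ := hcov
  have hTc : T.card = t + 1 := by
    by_contra hne
    obtain ⟨G, hG, hlt⟩ := hnc T (by omega)
    exact absurd (hT G hG) (by omega)
  have hsum := card_le_card_heavy_add (c := c) h𝓕 hint (fun U hU => hnc U hU.le) hTc hT
  rw [e3] at hsum
  have hc1 : (t + 1 + j - t + 1) * Nat.stirlingSecond (n - (t + 2)) (t + 1 + j - (t + 2)) ≤ c := by
    rw [e2, e3]; exact Nat.mul_le_mul_right _ (le_max_left _ _)
  have hc2 : (t + 1) * Nat.stirlingSecond (n - (t + 2)) (t + 1 + j - (t + 2)) ≤ c := by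
    rw [e2]; exact Nat.mul_le_mul_right _ (le_max_right _ _)
  have hcover : ∀ T ∈ heavySets t c 𝓕, ∀ G ∈ 𝓕, t ≤ (T ∩ G).card := fun T hT G hG =>
    le_card_inter_of_mem_heavySets h𝓕 hint (by omega) hc1 hT hG
  by_cases h2 : (heavySets t c 𝓕).card ≤ 2
  · left
    refine hsum.trans (Nat.add_le_add_right ?_ _)
    refine (Finset.card_biUnion_le_card_mul _ _ (Nat.stirlingSecond (n - (t + 1)) j)
      fun T hT => ?_).trans (Nat.mul_le_mul_right _ h2)
    have := card_star_le h𝓕 (mem_heavySets.1 hT).1 (by omega)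
    rwa [e1] at this
  · right
    rcases exists_common_or_three (fun T hT => (mem_heavySets.1 hT).1)
      (fun T hT T' hT' => le_card_inter_of_heavySets h𝓕 hint (by omega) hc1 hc2 hT hT')
      (show 2 ≤ (heavySets t c 𝓕).card by omega) with
      ⟨X, hX, hXT⟩ | ⟨T₁, h₁, T₂, h₂, x, hx, hZ, h₃⟩
    · right
      obtain ⟨𝓑, hd, hBc, hB⟩ :=
        exists_blocks_of_common hX (fun T hT => (mem_heavySets.1 hT).1) hXT
      obtain ⟨G, hG, hXG⟩ := hntX X hX
      have hcov : ∀ B ∈ 𝓑, ∀ G ∈ 𝓕, t ≤ (insert B X ∩ G).card := fun B hB' =>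
        hcover _ ((hB B).1 hB').2
      have hpart : ∀ B ∈ 𝓑, IsPartition (insert B X) := fun B hB' =>
        isPartition_of_mem_heavySets h𝓕 ((hB B).1 hB').2
      have hne : 𝓑.Nonempty := Finset.card_pos.1 (by omega)
      have hlight : ∀ B, B ∉ X → B ∉ 𝓑 → (star 𝓕 (insert B X)).card ≤ c := by
        intro B hBX hBn
        by_contra! hlt
        exact hBn ((hB B).2 ⟨hBX, mem_heavySets.2 ⟨by
          rw [Finset.card_insert_of_notMem hBX, hX], hlt⟩⟩)
      have hle := card_blocks_le h𝓕 hX hne hd hcov hpart hG hXG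
      have hcard := card_le_card_meetingFamily_add h𝓕 hint (by omega) hX hd (by omega) hcov hlight
        hG hXG
      rw [e2, e3] at hcard
      exact ⟨X, 𝓑, hX, hd, isPartition_union_of_cover h𝓕 hX hne hcov hpart hG hXG, by omega,
        hcard, fun h => eq_familyH hmax (by omega) hX hne hd (by omega) hcov hpart hG hXG⟩
    · left
      refine ⟨T₁ ∪ T₂, isPartition_union_of_three (isPartition_of_mem_heavySets h𝓕 h₁)
        (isPartition_of_mem_heavySets h𝓕 h₂) hx (isPartition_of_mem_heavySets h𝓕 h₃), hZ,
        hmax.eq_of_subset (fun F hF => ?_) (Finset.filter_subset _ _)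
          (familyA_isIntersecting hZ)⟩
      exact Finset.mem_filter.2 ⟨h𝓕 hF, add_one_le_card_inter_of_three (mem_heavySets.1 h₁).1
        (mem_heavySets.1 h₂).1 hZ hx (hcover _ h₁ F hF) (hcover _ h₂ F hF) (hcover _ h₃ F hF)⟩

theorem eq_singletons_of_card_eq_one {P : Finset (Finset (Fin n))} (h : ∀ B ∈ P, B.card = 1) :
    P = singletons (support P) := by
  ext B
  rw [mem_singletons]
  constructor
  · intro hB
    obtain ⟨x, rfl⟩ := Finset.card_eq_one.1 (h B hB)
    exact ⟨x, mem_support.2 ⟨_, hB, Finset.mem_singleton_self x⟩, rfl⟩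
  · rintro ⟨x, hx, rfl⟩
    obtain ⟨A, hA, hxA⟩ := mem_support.1 hx
    obtain ⟨y, rfl⟩ := Finset.card_eq_one.1 (h A hA)
    rw [Finset.mem_singleton] at hxA
    rwa [hxA]

theorem IsPartition.eq_singletons_or_lt {P : Finset (Finset (Fin n))} (hP : IsPartition P) :
    P = singletons (support P) ∨ P.card < (support P).card := by
  by_cases h : ∀ B ∈ P, B.card = 1
  · exact Or.inl (eq_singletons_of_card_eq_one h)
  · right
    push Not at h
    obtain ⟨B, hB, hB1⟩ := h
    rw [hP.card_support, Finset.card_eq_sum_ones]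
    refine Finset.sum_lt_sum (fun C hC => (hP.1 C hC).card_pos) ⟨B, hB, ?_⟩
    have := (hP.1 B hB).card_pos
    omega

theorem disjoint_support_of_isPartition_union (hp : IsPartition (X ∪ 𝓑)) (hd : Disjoint X 𝓑) :
    Disjoint (support X) (support 𝓑) := by
  rw [Finset.disjoint_left]
  intro x hx hx'
  obtain ⟨A, hA, hxA⟩ := mem_support.1 hx
  obtain ⟨B, hB, hxB⟩ := mem_support.1 hx'
  have := hp.eq_of_mem (Finset.mem_union_left _ hA) (Finset.mem_union_right _ hB) hxA hxB
  exact Finset.disjoint_left.1 hd hA (this ▸ hB)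

theorem card_meetingFamily_le_singletonCount {A : Finset (Fin n)} (hA : A.card + 2 ≤ k)
    (hp : IsPartition (singletons A ∪ 𝓑)) (hd : Disjoint (singletons A) 𝓑) :
    (meetingFamily n k (singletons A) 𝓑).card ≤ singletonCount n k A.card 𝓑.card := by
  obtain ⟨C, hCs, hCc, hC⟩ := exists_card_meetingFamily_le (k := k)
    (by rwa [card_singletons])
    (hp.mono Finset.subset_union_right) hd
  have hds := disjoint_support_of_isPartition_union hp hd
  rw [support_singletons] at hds
  rwa [card_meetingFamily_singletons (hds.mono_right hCs), hCc] at hC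

theorem card_meetingFamily_le_of_lt_support (hk : X.card + 2 ≤ k) (hd : Disjoint X 𝓑)
    (hX : X.card < (support X).card) : (meetingFamily n k X 𝓑).card
      ≤ 𝓑.card * Nat.stirlingSecond (n - (X.card + 2)) (k - (X.card + 1)) := by
  refine card_meetingFamily_le_mul fun B hB => ?_
  have hBX : B ∉ X := fun h => Finset.disjoint_left.1 hd h hB
  refine card_star_le_of_support subset_rfl (Finset.card_insert_of_notMem hBX) (by omega)
    fun hp => ?_
  have h1 := hp.card_support
  rw [Finset.sum_insert hBX, ← (hp.mono (Finset.subset_insert B X)).card_support] at h1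
  have := (hp.1 B (Finset.mem_insert_self _ _)).card_pos
  omega

theorem isomorphic_familyH₀ {A C : Finset (Fin n)} (hd : Disjoint A C) (hA : A.card = t)
    (hC : A.card + C.card = k) :
    Isomorphic (familyH n k (singletons A) (singletons A ∪ singletons C)) (familyH₀ n k t) := by
  obtain ⟨σ, h1, h2, -⟩ := exists_perm_chain (A := A) (C := A ∪ C) (E := A ∪ C)
    Finset.subset_union_left subset_rfl
  refine ⟨σ, ?_⟩
  change (familyH n k _ _).image (relabel σ) = _
  rw [image_relabel_familyH, ← singletons_union, relabel_singletons, relabel_singletons, h1, h2,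
    Finset.card_union_of_disjoint hd, hA, ← hA, hC, hA]
  rfl

theorem isomorphic_familyH₁ {A C B : Finset (Fin n)} (hd : Disjoint A C)
    (hB : Disjoint B (A ∪ C)) (hB2 : B.card = 2) (hA : A.card = t)
    (hC : A.card + C.card + 1 = k) :
    Isomorphic (familyH n k (singletons A) (singletons A ∪ insert B (singletons C)))
      (familyH₁ n k t) := by
  obtain ⟨σ, h1, h2, h3⟩ := exists_perm_chain (A := A) (C := A ∪ C) (E := A ∪ C ∪ B)
    Finset.subset_union_left Finset.subset_union_left
  refine ⟨σ, ?_⟩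
  change (familyH n k _ _).image (relabel σ) = _
  have hc1 : (A ∪ C).card = k - 1 := by rw [Finset.card_union_of_disjoint hd]; omega
  have hc2 : (A ∪ C ∪ B).card = k + 1 := by
    rw [Finset.card_union_of_disjoint hB.symm, hc1, hB2]; omega
  have hBσ : B.image σ = firstElems n (k + 1) \ firstElems n (k - 1) := by
    rw [← hc2, ← h3, ← hc1, ← h2, ← Finset.image_sdiff _ _ σ.injective,
      Finset.union_sdiff_cancel_left hB.symm]
  have hM : singletons A ∪ insert B (singletons C) = singletons (A ∪ C) ∪ {B} := by
    rw [singletons_union, Finset.insert_eq, Finset.union_comm {B}, Finset.union_assoc]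
  rw [image_relabel_familyH, hM, relabel_union, relabel_singletons, relabel_singletons,
    relabel_singleton, h1, h2, hBσ, hc1, hA]
  rfl

/-- The block `B` contributes at most as many members as there are partitions completing
`X ∪ {B}`. -/
theorem card_meetingFamily_le_erase_add {A : Finset (Fin n)} {B : Finset (Fin n)} {b : ℕ}
    (hk : A.card + 2 ≤ k) (hB : B ∈ 𝓑)
    (hd : Disjoint (singletons A) 𝓑) (hb : b ≤ B.card) :
    (meetingFamily n k (singletons A) 𝓑).card
      ≤ (meetingFamily n k (singletons A) (𝓑.erase B)).card
        + Nat.stirlingSecond (n - (A.card + b)) (k - (A.card + 1)) := by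
  conv_lhs => rw [← Finset.insert_erase hB]
  rw [card_meetingFamily_insert]
  refine Nat.add_le_add_left ((card_avoidingFamily_le B).trans ?_) _
  have hBX : B ∉ singletons A := fun h => Finset.disjoint_left.1 hd h hB
  refine card_star_le_of_support subset_rfl
    (by rw [Finset.card_insert_of_notMem hBX, card_singletons]) (by omega) fun hp => ?_
  have h1 := hp.card_support
  rw [Finset.sum_insert hBX, ← (hp.mono (Finset.subset_insert B _)).card_support,
    support_singletons] at h1
  omega

/-- The numerical facts behind the final comparisons, for `f₁ = S(n - t - 1, j)`,
`f₂ = S(n - t - 2, j - 1)` and `s₂ = S(n - t - 2, j)`. -/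
theorem numeric_facts (ht : 1 ≤ t) (hj : 2 ≤ j)
    (hN : 4 ^ (t + 1) * (((t + 1) * (j + 2)) ^ 2) ^ (j + 2) ≤ 2 ^ n) {f₁ f₂ s₂ : ℕ}
    (hf₁ : f₁ = Nat.stirlingSecond (n - (t + 1)) j)
    (hf₂ : f₂ = Nat.stirlingSecond (n - (t + 2)) (j - 1))
    (hs₂ : s₂ = Nat.stirlingSecond (n - (t + 2)) j) :
    0 < f₂ ∧ 0 < f₁ ∧ j * s₂ ≤ f₁ ∧ (t + 1) ^ 2 * (j + 2) * f₂ ≤ s₂ ∧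
      8 * ((j + 1).choose 2 * f₂) ≤ f₁ ∧
      2 * ((t + 1) * ((j + 2) * (max (j + 2) (t + 1) * f₂))) ≤ f₁ ∧
      4 * ((j + 2) * (max (j + 2) (t + 1) * f₂)) ≤ f₁ ∧ 16 * (t * f₂) ≤ f₁ := by
  have hn := two_mul_le_of_two_pow_ge hN
  have hD : ((t + 1) * (j + 2)) ^ 2 * f₂ ≤ f₁ := by
    have := ratio_le (by omega) hN (a := t + 1) (by omega) (by omega)
    rwa [show t + 1 + j - (t + 1 + 1) = j - 1 by omega, show t + 1 + j - (t + 1) = j by omega,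
      ← hf₁, show t + 1 + 1 = t + 2 by ring, ← hf₂] at this
  have hf₂0 : 0 < f₂ := hf₂ ▸ stirlingSecond_pos (by omega) (by omega)
  have hj1 : j * s₂ ≤ f₁ := by
    have := mul_stirlingSecond_le (n - (t + 2)) j
    rwa [show n - (t + 2) + 1 = n - (t + 1) by omega, ← hs₂, ← hf₁] at this
  have hs : (t + 1) ^ 2 * (j + 2) * f₂ ≤ s₂ := by
    rw [hf₂, hs₂]; exact ratio_same_ground_le hj hN
  have hle : ∀ a, a ≤ ((t + 1) * (j + 2)) ^ 2 → a * f₂ ≤ f₁ := fun a ha =>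
    (Nat.mul_le_mul_right _ ha).trans hD
  have hch : (j + 1).choose 2 * 2 = (j + 1) * j := by
    have := Nat.add_one_mul_choose_eq j 1
    rw [Nat.choose_one_right] at this
    exact this.symm
  have hsq : 4 ≤ (t + 1) ^ 2 := Nat.pow_le_pow_left (show 2 ≤ t + 1 by omega) 2
  have hsq' : 16 ≤ (j + 2) ^ 2 := Nat.pow_le_pow_left (show 4 ≤ j + 2 by omega) 2
  have hsq4 : 4 * (j + 2) ^ 2 ≤ ((t + 1) * (j + 2)) ^ 2 := by
    rw [mul_pow]; exact Nat.mul_le_mul_right _ hsq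
  have hsq16 : (t + 1) ^ 2 * 16 ≤ ((t + 1) * (j + 2)) ^ 2 := by
    rw [mul_pow]; exact Nat.mul_le_mul_left _ hsq'
  refine ⟨hf₂0, ?_, hj1, hs, ?_, ?_, ?_, ?_⟩
  · exact lt_of_lt_of_le (Nat.mul_pos (by positivity) hf₂0) hD
  · have := hle (8 * (j + 1).choose 2) (by nlinarith)
    linarith
  · have := hle (2 * ((t + 1) * ((j + 2) * max (j + 2) (t + 1)))) (by
      have : 2 * max (j + 2) (t + 1) ≤ (t + 1) * (j + 2) := by
        rcases max_cases (j + 2) (t + 1) with ⟨h, -⟩ | ⟨h, -⟩ <;> rw [h] <;> nlinarith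
      calc 2 * ((t + 1) * ((j + 2) * max (j + 2) (t + 1)))
          = ((t + 1) * (j + 2)) * (2 * max (j + 2) (t + 1)) := by ring
        _ ≤ ((t + 1) * (j + 2)) * ((t + 1) * (j + 2)) := Nat.mul_le_mul_left _ this
        _ = _ := by ring)
    linarith
  · have := hle (4 * ((j + 2) * max (j + 2) (t + 1))) (by
      rcases max_cases (j + 2) (t + 1) with ⟨h, -⟩ | ⟨h, -⟩ <;> rw [h]
      · nlinarith
      · calc 4 * ((j + 2) * (t + 1)) = ((t + 1) * (j + 2)) * 4 := by ring
          _ ≤ ((t + 1) * (j + 2)) * ((t + 1) * (j + 2)) :=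
            Nat.mul_le_mul_left _ (by nlinarith)
          _ = _ := by ring)
    linarith
  · have := hle (16 * t) (by nlinarith)
    linarith

end BlockPartition

/-! ### Comparison with the threshold -/

namespace BlockPartition

variable {n t j : ℕ} {𝓕 : Finset (Finset (Finset (Fin n)))} {X 𝓑 : Finset (Finset (Fin n))}

/-- Families that beat `familyH₀` when `k ≤ 2 t + 2`. -/
theorem eq_familyA_of_card_lt (ht : 1 ≤ t) (hj : 2 ≤ j)
    (hN : 4 ^ (t + 1) * (((t + 1) * (j + 2)) ^ 2) ^ (j + 2) ≤ 2 ^ n)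
    (hmax : IsMaximalIntersecting n (t + 1 + j) t 𝓕) (hnt : ¬ IsTrivial t 𝓕)
    (hlt : (familyH₀ n (t + 1 + j) t).card < 𝓕.card) :
    ∃ Z : Finset (Finset (Fin n)), IsPartition Z ∧ Z.card = t + 2 ∧
      𝓕 = familyA n (t + 1 + j) t Z := by
  have hn := two_mul_le_of_two_pow_ge hN
  have e1 : t + 1 + j - (t + 1) = j := by omega
  have e2 : t + 1 + j - (t + 2) = j - 1 := by omega
  have hH := le_card_familyH₀ (n := n) (k := t + 1 + j) (t := t) (by omega) (by omega)
  have hN1 := le_singletonCount (n := n) (k := t + 1 + j) (t := t) (c := j + 1)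
    (by omega) (by omega)
  rw [show t + 1 + j - t = j + 1 by omega] at hH
  rw [e1, e2] at hN1
  obtain ⟨hf₂0, hf₁0, hjs, -, hch, herr1, herr2, herr3⟩ := numeric_facts ht hj hN rfl rfl rfl
  have hst := structure_of_maximal hj hN hmax hnt
  set f₁ := Nat.stirlingSecond (n - (t + 1)) j with hf₁
  set f₂ := Nat.stirlingSecond (n - (t + 2)) (j - 1) with hf₂
  set s₂ := Nat.stirlingSecond (n - (t + 2)) j with hs₂
  have hj2 : 2 * f₁ ≤ j * f₁ := Nat.mul_le_mul_right _ hj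
  have hjs2 : 2 * s₂ ≤ j * s₂ := Nat.mul_le_mul_right _ hj
  rw [Nat.succ_mul] at hN1
  rcases hst with h | h | ⟨X, 𝓑, hX, hd, hp, hBle, hcard, hfull⟩
  · omega
  · exact h
  · exfalso
    rcases Nat.lt_or_eq_of_le hBle with hlt' | heq
    · have h1 : (meetingFamily n (t + 1 + j) X 𝓑).card ≤ 𝓑.card * f₁ := by
        refine card_meetingFamily_le_mul fun B hB => ?_
        have := card_star_le (k := t + 1 + j) (a := t + 1) (U := insert B X) subset_rfl
          (by rw [Finset.card_insert_of_notMem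
            (fun h => Finset.disjoint_left.1 hd h hB), hX]) (by omega)
        rwa [e1] at this
      have h2 : 𝓑.card * f₁ ≤ j * f₁ := Nat.mul_le_mul_right _ (by omega)
      have h3 : (j + 2 - 𝓑.card) * (max (j + 2) (t + 1) * f₂)
          ≤ (j + 2) * (max (j + 2) (t + 1) * f₂) := Nat.mul_le_mul_right _ (by omega)
      omega
    · have h1 := card_familyH_le (n := n) (k := t + 1 + j) hd hX
      rw [← hfull heq] at h1
      rcases (hp.mono Finset.subset_union_left).eq_singletons_or_lt with hXs | hXs
      · have hAc : (support X).card = t := by rw [← card_singletons, ← hXs, hX]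
        rw [hXs] at hp hd h1
        have h2 := card_meetingFamily_le_singletonCount (k := t + 1 + j) (by omega) hp hd
        rw [hAc, heq] at h2
        omega
      · have h2 := card_meetingFamily_le_of_lt_support (k := t + 1 + j) (by omega) hd hXs
        rw [hX, heq, e1, ← hs₂, Nat.succ_mul] at h2
        omega

/-- Families that nearly reach `familyH₀` when `2 t + 3 ≤ k`. -/
theorem isomorphic_of_card_ge (ht : 1 ≤ t) (htj : t + 2 ≤ j)
    (hN : 4 ^ (t + 1) * (((t + 1) * (j + 2)) ^ 2) ^ (j + 2) ≤ 2 ^ n)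
    (hmax : IsMaximalIntersecting n (t + 1 + j) t 𝓕) (hnt : ¬ IsTrivial t 𝓕)
    (hge : (familyH₀ n (t + 1 + j) t).card + Nat.stirlingSecond (n - (t + 2)) j
      ≤ 𝓕.card + Nat.stirlingSecond (n - (t + 1)) j) :
    Isomorphic 𝓕 (familyH₀ n (t + 1 + j) t) ∨ Isomorphic 𝓕 (familyH₁ n (t + 1 + j) t) := by
  have hn := two_mul_le_of_two_pow_ge hN
  have e1 : t + 1 + j - (t + 1) = j := by omega
  have e2 : t + 1 + j - (t + 2) = j - 1 := by omega
  obtain ⟨i, rfl⟩ : ∃ i, j = i + 1 := ⟨j - 1, by omega⟩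
  have hH := le_card_familyH₀ (n := n) (k := t + 1 + (i + 1)) (t := t) (by omega) (by omega)
  have hNj := le_singletonCount (n := n) (k := t + 1 + (i + 1)) (t := t) (c := i + 1)
    (by omega) (by omega)
  have hstep := le_singletonCount_succ (n := n) (k := t + 1 + (i + 1)) (t := t) (c := i + 1)
    (by omega) (by omega)
  have hstep' := le_singletonCount_succ (n := n) (k := t + 1 + (i + 1)) (t := t) (c := i)
    (by omega) (by omega)
  rw [show t + 1 + (i + 1) - t = i + 1 + 1 by omega] at hH
  rw [e1, e2] at hNj hstep hstep'
  obtain ⟨hf₂0, hf₁0, hjs, hs, hch, herr1, herr2, herr3⟩ :=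
    numeric_facts ht (by omega : 2 ≤ i + 1) hN rfl rfl rfl
  have hst := structure_of_maximal (by omega) hN hmax hnt
  set f₁ := Nat.stirlingSecond (n - (t + 1)) (i + 1) with hf₁
  set f₂ := Nat.stirlingSecond (n - (t + 2)) (i + 1 - 1) with hf₂
  set s₂ := Nat.stirlingSecond (n - (t + 2)) (i + 1) with hs₂
  have hs4 : 4 * ((i + 3) * f₂) ≤ s₂ := by
    refine le_trans ?_ hs
    have : 4 ≤ (t + 1) ^ 2 := Nat.pow_le_pow_left (show 2 ≤ t + 1 by omega) 2
    nlinarith [Nat.mul_le_mul_right ((i + 3) * f₂) this]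
  have hif : (i + 1) * f₂ = i * f₂ + f₂ := Nat.succ_mul _ _
  have hif' : (i + 3) * f₂ = i * f₂ + 3 * f₂ := Nat.add_mul _ _ _
  have hti : t * f₂ ≤ i * f₂ := Nat.mul_le_mul_right _ (by omega)
  have hj3 : 3 * s₂ ≤ (i + 1) * s₂ := Nat.mul_le_mul_right _ (by omega)
  have hch' : (i + 1 + 1).choose 2 * f₂ = (i + 1) * f₂ + (i + 1).choose 2 * f₂ := by
    rw [Nat.choose_succ_succ' (i + 1) 1, Nat.choose_one_right, Nat.add_mul]
  -- the lower bound for `𝓕` in terms of the partitions meeting only `k - t - 1` singletons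
  have hlow : singletonCount n (t + 1 + (i + 1)) t (i + 1) + t + s₂
      ≤ 𝓕.card + (i + 1) * f₂ := by omega
  have hj2 : 3 * f₁ ≤ (i + 1) * f₁ := Nat.mul_le_mul_right _ (by omega)
  rcases hst with h | ⟨Z, -, hZ, hFZ⟩ | ⟨X, 𝓑, hX, hd, hp, hBle, hcard, hfull⟩
  · omega
  · exfalso
    have h1 := card_familyA_le (n := n) (k := t + 1 + (i + 1)) hZ (by omega)
    rw [← hFZ, e1, ← hf₁] at h1
    rcases Nat.lt_or_eq_of_le htj with hlt | heq
    · have h2 : (t + 2) * f₁ ≤ i * f₁ := Nat.mul_le_mul_right _ (by omega)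
      rw [Nat.succ_mul] at hNj
      omega
    · obtain rfl : i = t + 1 := by omega
      have h2 : (t + 1 + 1 + 1).choose 2 * f₂ ≤ s₂ := by
        refine le_trans (Nat.mul_le_mul_right _ ?_) hs
        have h3 := Nat.add_one_mul_choose_eq (t + 1 + 1) 1
        rw [Nat.choose_one_right] at h3
        nlinarith [Nat.zero_le t, Nat.zero_le (t ^ 2), Nat.zero_le (t ^ 3)]
      have h4 : (t + 1 + 1) * f₁ = (t + 2) * f₁ := by ring
      omega
  · have herr : (i + 1 + 2 - 𝓑.card) * (max (i + 1 + 2) (t + 1) * f₂)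
        ≤ (i + 1 + 2) * (max (i + 1 + 2) (t + 1) * f₂) := Nat.mul_le_mul_right _ (by omega)
    rcases (hp.mono Finset.subset_union_left).eq_singletons_or_lt with hXs | hXs
    swap
    · exfalso
      have h2 := card_meetingFamily_le_of_lt_support (k := t + 1 + (i + 1)) (by omega) hd hXs
      rw [hX, e1, ← hs₂] at h2
      have h3 : 𝓑.card * s₂ ≤ (i + 1 + 1) * s₂ := Nat.mul_le_mul_right _ hBle
      rw [Nat.succ_mul (i + 1)] at h3
      omega
    have hAc : (support X).card = t := by rw [← card_singletons, ← hXs, hX]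
    generalize support X = A at hXs hAc
    subst hXs
    have hsc := card_meetingFamily_le_singletonCount (k := t + 1 + (i + 1)) (by omega) hp hd
    rw [hAc] at hsc
    rcases Nat.lt_or_ge 𝓑.card (i + 1) with hB | hB
    · exfalso
      have h1 : (meetingFamily n (t + 1 + (i + 1)) (singletons A) 𝓑).card ≤ 𝓑.card * f₁ := by
        refine card_meetingFamily_le_mul fun B hB => ?_
        have := card_star_le (k := t + 1 + (i + 1)) (a := t + 1) (U := insert B (singletons A))
          subset_rfl (by rw [Finset.card_insert_of_notMem
            (fun h => Finset.disjoint_left.1 hd h hB), hX]) (by omega)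
        rwa [e1] at this
      have h2 : 𝓑.card * f₁ ≤ i * f₁ := Nat.mul_le_mul_right _ (by omega)
      rw [Nat.succ_mul] at hNj
      omega
    rcases Nat.lt_or_eq_of_le hBle with hB' | hB'
    · exfalso
      have hBi : 𝓑.card = i + 1 := by omega
      rw [hBi] at hsc
      rw [hBi, show i + 1 + 2 - (i + 1) = 2 by omega, max_eq_left (by omega)] at hcard
      have h3 : (i + 1 + 2) * f₂ = i * f₂ + 3 * f₂ := by ring
      omega
    -- from here on `𝓕 = familyH` with `|𝓑| = k - t`, and the sizes of the blocks in `𝓑` decide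
    have hFH := hfull hB'
    have hle := card_familyH_le (n := n) (k := t + 1 + (i + 1)) hd hX
    rw [← hFH] at hle
    have hds := disjoint_support_of_isPartition_union hp hd
    rw [support_singletons] at hds
    have hpB : IsPartition 𝓑 := hp.mono Finset.subset_union_right
    by_cases hall : ∀ B ∈ 𝓑, B.card = 1
    · left
      have hBs := eq_singletons_of_card_eq_one hall
      have hBc : (support 𝓑).card = i + 1 + 1 := by rw [← card_singletons, ← hBs, hB']
      rw [hFH, hBs]
      exact isomorphic_familyH₀ hds hAc (by rw [hAc, hBc]; ring)
    · push Not at hall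
      obtain ⟨B, hBmem, hB1⟩ := hall
      have hBpos := (hpB.1 B hBmem).card_pos
      have hdE : Disjoint (singletons A) (𝓑.erase B) := hd.mono_right (Finset.erase_subset _ _)
      have hpE : IsPartition (singletons A ∪ 𝓑.erase B) :=
        hp.mono (Finset.union_subset_union_right (Finset.erase_subset _ _))
      have hEc : (𝓑.erase B).card = i + 1 := by
        rw [Finset.card_erase_of_mem hBmem, hB']; omega
      have hscE := card_meetingFamily_le_singletonCount (k := t + 1 + (i + 1)) (by omega) hpE hdE
      rw [hAc, hEc] at hscE
      rcases Nat.lt_or_ge 2 B.card with hB3 | hB2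
      · exfalso
        have h1 := card_meetingFamily_le_erase_add (k := t + 1 + (i + 1)) (b := 3) (by omega)
          hBmem hd hB3
        rw [hAc, e1] at h1
        have h2 := mul_stirlingSecond_le (n - (t + 3)) (i + 1)
        rw [show n - (t + 3) + 1 = n - (t + 2) by omega, ← hs₂] at h2
        have h3 : 3 * Nat.stirlingSecond (n - (t + 3)) (i + 1)
            ≤ (i + 1) * Nat.stirlingSecond (n - (t + 3)) (i + 1) :=
          Nat.mul_le_mul_right _ (by omega)
        omega
      have h1 := card_meetingFamily_le_erase_add (k := t + 1 + (i + 1)) (b := 2) (by omega)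
        hBmem hd (by omega)
      rw [hAc, e1, ← hs₂] at h1
      by_cases hall' : ∀ C ∈ 𝓑.erase B, C.card = 1
      · right
        have hBs := eq_singletons_of_card_eq_one hall'
        have hBc : (support (𝓑.erase B)).card = i + 1 := by rw [← card_singletons, ← hBs, hEc]
        have hsub : support (𝓑.erase B) ⊆ support 𝓑 := by
          rw [support_erase hpB hBmem]; exact Finset.sdiff_subset
        have hBsub : B ⊆ support 𝓑 := fun x hx => mem_support.2 ⟨B, hBmem, hx⟩
        have hiso := isomorphic_familyH₁ (n := n) (k := t + 1 + (i + 1)) (hds.mono_right hsub)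
          (B := B) (by
            rw [Finset.disjoint_union_right]
            exact ⟨(hds.mono_right hBsub).symm, hpB.disjoint_support_erase hBmem⟩)
          (by omega) hAc (by rw [hAc, hBc]; ring)
        rwa [← hBs, Finset.insert_erase hBmem, ← hFH] at hiso
      · exfalso
        push Not at hall'
        obtain ⟨C, hCmem, hC1⟩ := hall'
        have hCpos := (hpB.1 C (Finset.mem_of_mem_erase hCmem)).card_pos
        have h2 := card_meetingFamily_le_erase_add (k := t + 1 + (i + 1)) (b := 2) (by omega)
          hCmem hdE (by omega)
        have h3 := card_meetingFamily_le_singletonCount (k := t + 1 + (i + 1)) (by omega)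
          (hpE.mono (Finset.union_subset_union_right (Finset.erase_subset C _)))
          (hdE.mono_right (Finset.erase_subset C _))
        rw [hAc, Finset.card_erase_of_mem hCmem, hEc, Nat.add_sub_cancel] at h3
        rw [hAc, e1, ← hs₂] at h2
        omega

end BlockPartition

theorem theorem3 (n k t : ℕ) (ht : 1 ≤ t) (hk : t + 3 ≤ k)
    (hn : 2 * BlockPartition.boundL k t ≤ (n : ℝ))
    (𝓕 : Finset (Finset (Finset (Fin n))))
    (hmax : BlockPartition.IsMaximalIntersecting n k t 𝓕)
    (hnontriv : ¬ BlockPartition.IsTrivial t 𝓕) :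
    (2 * t + 3 ≤ k →
      ((BlockPartition.familyH₀ n k t).card : ℤ)
          - (Nat.stirlingSecond (n - t - 1) (k - t - 1) : ℤ)
          + (Nat.stirlingSecond (n - t - 2) (k - t - 1) : ℤ) ≤ (𝓕.card : ℤ) →
      BlockPartition.Isomorphic 𝓕 (BlockPartition.familyH₀ n k t) ∨
        BlockPartition.Isomorphic 𝓕 (BlockPartition.familyH₁ n k t)) ∧
    (k ≤ 2 * t + 2 →
      (BlockPartition.familyH₀ n k t).card < 𝓕.card →
      ∃ Z : Finset (Finset (Fin n)), BlockPartition.IsPartition Z ∧ Z.card = t + 2 ∧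
        𝓕 = BlockPartition.familyA n k t Z) := by
  obtain ⟨j, rfl⟩ : ∃ j, k = t + 1 + j := ⟨k - (t + 1), by omega⟩
  have hN := BlockPartition.two_pow_ge_of_boundL hn
  refine ⟨fun h2 hge => ?_, fun _ hlt =>
    BlockPartition.eq_familyA_of_card_lt ht (by omega) hN hmax hnontriv hlt⟩
  refine BlockPartition.isomorphic_of_card_ge ht (by omega) hN hmax hnontriv ?_
  rw [Nat.sub_sub, Nat.sub_sub, Nat.sub_sub, Nat.add_sub_cancel_left] at hge
  omega
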